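/- Let $\mathbb K\in\{\mathbb R,\mathbb C\}$. Lie groups are modelled on (Hausdorff) locally convex $\mathbb K$-vector spaces, and smoothness is understood in the sense of Michal--Bastiani ($f$ is $C^1$ if it is continuous and all directional derivatives exist and define a continuous map $(x,h)\mapsto df(x)(h)$; $f$ is $C^n$ if moreover $df$ is $C^{n-1}$; smooth means $C^n$ for all $n$). **Definitions.** A subgroup $H$ of a Lie group $G$ is a *split Lie subgroup* if it carries a Lie group structure and $G/H$ a manifold structure for which $H\hookrightarrow G$ is a morphism of Lie groups and $G\to G/H$ is a smooth $H$-principal bundle. An *extension of Lie groups* $N\to\widehat G\xrightarrow{q}G$ is a short exact sequence of Lie group morphisms which makes $\widehat G$ a smooth $N$-principal bundle over $G$ (so that $G\cong\widehat G/N$); two extensions of $G$ by $N$ are *equivalent* if there is a Lie group morphism between the total groups inducing the identity on $N$ and on $G$. For an extension let $C_N:\widehat G\to\mathrm{Aut}(N)$ be the conjugation action, and for $n\in N$ write also $C_N(n)$ for the inner automorphism. $C^1_s(G,N)$ is the set of maps $f:G\to N$ with $f(1)=1$ which are smooth on an identity neighbourhood. $C^2_{ss}(G,N)$ is the set of maps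 $\omega:G\times G\to N$ with $\omega(g,1)=\omega(1,g)=1$ which are smooth on an identity neighbourhood and for which each map $x\mapsto\omega(g,x)\,\omega(gxg^{-1},g)^{-1}$ is smooth on an identity neighbourhood. A *strongly smooth outer action* of $G$ on $N$ is a map $S$ from $G$ to the group $\mathrm{Aut}(N)$ of Lie group automorphisms with $S(1)=\mathrm{id}$, such that $(g,n)\mapsto S(g)(n)$ is smooth on $U\times N$ for an identity neighbourhood $U\subseteq G$, and such that $\delta_S(g,g'):=S(g)S(g')S(gg')^{-1}=C_N(\omega(g,g'))$ for some $\omega\in C^2_{ss}(G,N)$. Write $S\sim S'$ if $S'=(C_N\circ h)\cdot S$ for some $h\in C^1_s(G,N)$, and $[S]$ for the class of $S$. An extension $q:\widehat G\to G$ of $G$ by $N$ *corresponds to* $[S]$ if $C_N\circ\sigma\sim S$ for a normalized section $\sigma:G\to\widehat G$ of $q$ that is smooth on an identity neighbourhood; $\mathrm{Ext}(G,N)_{[S]}$ is the set of equivalence classes of these extensions. **Setting.** Let $G,N$ be Lie groups such that the center $Z(N)$ is a split Lie subgroup of $N$, let $N_{\rm ad}:=N/Z(N)\cong C_N(N)\subseteq\mathrm{Aut}(N)$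 with its quotient structure, and let $S$ be a strongly smooth outer action of $G$ on $N$. Let $G^S$ be the group $N_{\rm ad}\times G$ with the product $$(C_N(n),g)(C_N(n'),g')=\bigl(C_N(n)\,S(g)C_N(n')S(g)^{-1}\,\delta_S(g,g'),\,gg'\bigr),$$ let $q_S:G^S\to G$ be the projection, and let $\rho:G^S\to\mathrm{Aut}(N)$, $\rho(C_N(n),g)=C_N(n)S(g)$. **Proposition.** The group $G^S$ carries a natural Lie group structure, i.e. one for which, for some open identity neighbourhood $U\subseteq G$, the identity map $N_{\rm ad}\times U\to q_S^{-1}(U)$ is a diffeomorphism onto an open subset of $G^S$. With respect to it, $\rho$ turns $Z(N)$ into a smooth $G^S$-module, and the following holds. Let $q:\widehat G\to G$ be a Lie group extension of $G$ by $N$ corresponding to $[S]$. Then the map $$\gamma=(C_N\cdot(S\circ q)^{-1},q):\widehat G\to\mathrm{Aut}(N)\times G,\qquad x\mapsto\bigl(C_N(x)S(q(x))^{-1},q(x)\bigr)$$ takes values in $G^S$ and defines a Lie group extension $Z(N)\hookrightarrow\widehat G\xrightarrow{\gamma}G^S$ for which the associated action of $G^S$ on $Z(N)$ is the one given by $\rho$;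 moreover $Z(N)$ is a split Lie subgroup of $\widehat G$, and $\gamma$ induces an isomorphism of Lie groups $\widehat G/Z(N)\cong G^S$. 1. If $q_j:\widehat G_j\to G$, $j=1,2$, are equivalent extensions of $G$ by $N$ corresponding to $[S]$, then $\gamma_j:\widehat G_j\to G^S$ are equivalent extensions of $G^S$ by $Z(N)$. Hence there is a map $\tau:\mathrm{Ext}(G,N)_{[S]}\to\mathrm{Ext}(G^S,Z(N))_{[\rho]}$ sending the class of $q$ to the class of $\gamma$. 2. Let $\gamma:\widehat G^S\to G^S$ be a Lie group extension of $G^S$ by $Z(N)$. It corresponds to the $G^S$-module structure $\rho$ on $Z(N)$ and its class lies in the image of $\tau$ if and only if there exists a $G^S$-equivariant equivalence $\alpha:N\to\gamma^{-1}(N_{\rm ad})\subseteq\widehat G^S$ of central extensions of $N_{\rm ad}$ by $Z(N)$. Here $\gamma^{-1}(N_{\rm ad})$ carries its structure of a split Lie subgroup of $\widehat G^S$, $G^S$ acts on $N$ by $\rho$, and $\gamma(x)$ acts on $\gamma^{-1}(N_{\rm ad})$ by conjugation with $x\in\widehat G^S$. -/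

import Mathlib

open scoped Topology
open Filter Set

universe u v

namespace LCLie

/-! ### Differential calculus and manifolds modelled on locally convex spaces -/

/-- `IsCn 𝕜 n f U`: on the open set `U` the map `f` between topological vector spaces is `C^n`:
it is continuous on `U`, and for `n ≥ 1` all directional derivatives
`df x h = lim_{t → 0} t⁻¹ (f (x + t h) - f x)`, `x ∈ U`, exist and `df` is `C^{n-1}` on `U × E`. -/
def IsCn (𝕜 : Type v) [RCLike 𝕜] : ℕ → ∀ {E F : Type u}
    [AddCommGroup E] [Module 𝕜 E] [TopologicalSpace E]
    [AddCommGroup F] [Module 𝕜 F] [TopologicalSpace F], (E → F) → Set E → Prop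
  | 0, _, _, _, _, _, _, _, _, f, U => ContinuousOn f U
  | n + 1, E, F, _, _, _, _, _, _, f, U =>
      ContinuousOn f U ∧ ∃ df : E × E → F,
        (∀ x ∈ U, ∀ h : E, Tendsto (fun t : 𝕜 => t⁻¹ • (f (x + t • h) - f x)) (𝓝[≠] 0)
          (𝓝 (df (x, h)))) ∧
        IsCn 𝕜 n df (U ×ˢ univ)

section Calculus

variable {𝕜 : Type v} [RCLike 𝕜] {E E' F F' : Type u}
  [AddCommGroup E] [Module 𝕜 E] [TopologicalSpace E]
  [AddCommGroup E'] [Module 𝕜 E'] [TopologicalSpace E']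
  [AddCommGroup F] [Module 𝕜 F] [TopologicalSpace F]
  [AddCommGroup F'] [Module 𝕜 F'] [TopologicalSpace F']

theorem IsCn.mono {n : ℕ} : ∀ {E F : Type u}
    [AddCommGroup E] [Module 𝕜 E] [TopologicalSpace E]
    [AddCommGroup F] [Module 𝕜 F] [TopologicalSpace F] {f : E → F} {U V : Set E},
    IsCn 𝕜 n f U → V ⊆ U → IsCn 𝕜 n f V := by
  induction n with
  | zero => intro E F _ _ _ _ _ _ f U V h hV; exact ContinuousOn.mono h hV
  | succ n ih =>
    intro E F _ _ _ _ _ _ f U V h hV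
    obtain ⟨hc, df, hd, hdf⟩ := h
    exact ⟨hc.mono hV, df, fun x hx => hd x (hV hx), ih hdf (prod_mono hV le_rfl)⟩

theorem IsCn.comp_clm {n : ℕ} : ∀ {E E' F : Type u}
    [AddCommGroup E] [Module 𝕜 E] [TopologicalSpace E]
    [AddCommGroup E'] [Module 𝕜 E'] [TopologicalSpace E']
    [AddCommGroup F] [Module 𝕜 F] [TopologicalSpace F] {f : E → F} {U : Set E}
    (A : E' →L[𝕜] E), IsCn 𝕜 n f U → IsCn 𝕜 n (fun x => f (A x)) (A ⁻¹' U) := by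
  induction n with
  | zero =>
    intro E E' F _ _ _ _ _ _ _ _ _ f U A h
    exact ContinuousOn.comp (f := A) h A.continuous.continuousOn (fun x hx => hx)
  | succ n ih =>
    intro E E' F _ _ _ _ _ _ _ _ _ f U A h
    obtain ⟨hc, df, hd, hdf⟩ := h
    refine ⟨hc.comp A.continuous.continuousOn (fun x hx => hx),
      fun p => df (A p.1, A p.2), fun x hx k => ?_, ?_⟩
    · simpa using hd (A x) hx (A k)
    · exact (ih (A.prodMap A) hdf).mono (fun p hp => ⟨hp.1, mem_univ _⟩)

theorem IsCn.prodMk {n : ℕ} : ∀ {E F F' : Type u}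
    [AddCommGroup E] [Module 𝕜 E] [TopologicalSpace E]
    [AddCommGroup F] [Module 𝕜 F] [TopologicalSpace F]
    [AddCommGroup F'] [Module 𝕜 F'] [TopologicalSpace F'] {f : E → F} {g : E → F'} {U : Set E},
    IsCn 𝕜 n f U → IsCn 𝕜 n g U → IsCn 𝕜 n (fun x => (f x, g x)) U := by
  induction n with
  | zero =>
    intro E F F' _ _ _ _ _ _ _ _ _ f g U hf hg
    exact ContinuousOn.prodMk hf hg
  | succ n ih =>
    intro E F F' _ _ _ _ _ _ _ _ _ f g U hf hg
    obtain ⟨hc, df, hd, hdf⟩ := hf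
    obtain ⟨hc', dg, hd', hdg⟩ := hg
    exact ⟨hc.prodMk hc', fun p => (df p, dg p),
      fun x hx k => (hd x hx k).prodMk_nhds (hd' x hx k), ih hdf hdg⟩

theorem IsCn.prodMap {n : ℕ} {f : E → F} {g : E' → F'} {U : Set E} {V : Set E'}
    (hf : IsCn 𝕜 n f U) (hg : IsCn 𝕜 n g V) : IsCn 𝕜 n (Prod.map f g) (U ×ˢ V) :=
  ((hf.comp_clm (ContinuousLinearMap.fst 𝕜 E E')).mono fun _ h => h.1).prodMk
    ((hg.comp_clm (ContinuousLinearMap.snd 𝕜 E E')).mono fun _ h => h.2)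

end Calculus

/-- The structure of a smooth `𝕜`-manifold modelled on a (Hausdorff) locally convex space on a
set `M`: a locally convex model space, a Hausdorff topology on `M` and an atlas all of whose
coordinate changes are smooth. -/
structure Smooth (𝕜 : Type v) [RCLike 𝕜] (M : Type u) where
  Model : Type u
  [acg : AddCommGroup Model]
  [module : Module 𝕜 Model]
  [topModel : TopologicalSpace Model]
  [addGroup : IsTopologicalAddGroup Model]
  [contSMul : ContinuousSMul 𝕜 Model]
  [t2Model : T2Space Model]
  locConvex : @LocallyConvexSpace ℝ Model _ _ _ (Module.compHom Model (algebraMap ℝ 𝕜)) _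
  [top : TopologicalSpace M]
  [t2 : T2Space M]
  [charted : ChartedSpace Model M]
  compat : ∀ e ∈ atlas Model M, ∀ e' ∈ atlas Model M, ∀ n : ℕ,
    IsCn 𝕜 n (fun x => e' (e.symm x)) (e.symm.trans e').source

attribute [instance] Smooth.acg Smooth.module Smooth.topModel Smooth.addGroup Smooth.contSMul
  Smooth.t2Model

namespace Smooth

variable {𝕜 : Type v} [RCLike 𝕜] {M M' P : Type u}

/-- `U` is open in the topology of the manifold structure `A`. -/
def Open (A : Smooth 𝕜 M) (U : Set M) : Prop := IsOpen[A.top] U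

/-- The map `f` is smooth on the open set `U`, with respect to the manifold structures `A` on its
domain and `B` on its codomain. -/
def MapOn (A : Smooth 𝕜 M) (B : Smooth 𝕜 M') (f : M → M') (U : Set M) : Prop :=
  letI := A.top; letI := B.top; letI := A.charted; letI := B.charted
  ContinuousOn f U ∧ ∀ e ∈ atlas A.Model M, ∀ e' ∈ atlas B.Model M', ∀ n : ℕ,
    IsCn 𝕜 n (fun x => e' (f (e.symm x))) (e.target ∩ e.symm ⁻¹' (U ∩ f ⁻¹' e'.source))

/-- Smooth maps between manifolds. -/
def Map (A : Smooth 𝕜 M) (B : Smooth 𝕜 M') (f : M → M') : Prop := A.MapOn B f univ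

/-- Diffeomorphisms. -/
def Diffeo (A : Smooth 𝕜 M) (B : Smooth 𝕜 M') (f : M ≃ M') : Prop :=
  A.Map B f ∧ B.Map A f.symm

/-- The product manifold. -/
def prod (A : Smooth 𝕜 M) (B : Smooth 𝕜 M') : Smooth 𝕜 (M × M') :=
  letI := A.top; letI := B.top; letI := A.charted; letI := B.charted
  letI := A.t2; letI := B.t2
  { Model := A.Model × B.Model
    locConvex := by
      let _ : Module ℝ A.Model := Module.compHom A.Model (algebraMap ℝ 𝕜)
      let _ : Module ℝ B.Model := Module.compHom B.Model (algebraMap ℝ 𝕜)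
      have _ : LocallyConvexSpace ℝ A.Model := A.locConvex
      have _ : LocallyConvexSpace ℝ B.Model := B.locConvex
      exact (inferInstance : LocallyConvexSpace ℝ (A.Model × B.Model))
    charted := prodChartedSpace A.Model M B.Model M'
    compat := by
      rintro _ ⟨e₁, he₁, e₂, he₂, rfl⟩ _ ⟨e₁', he₁', e₂', he₂', rfl⟩ n
      refine ((A.compat e₁ he₁ e₁' he₁' n).prodMap (B.compat e₂ he₂ e₂' he₂' n)).mono ?_
      rintro ⟨x, y⟩ h
      simp only [OpenPartialHomeomorph.trans_source, OpenPartialHomeomorph.symm_source,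
        OpenPartialHomeomorph.prod_target, OpenPartialHomeomorph.prod_source, mem_inter_iff,
        mem_prod, mem_preimage] at h ⊢
      exact ⟨⟨h.1.1, h.2.1⟩, ⟨h.1.2, h.2.2⟩⟩ }

end Smooth

/-! ### Lie groups, split Lie subgroups and extensions -/

section LieGroups

variable {𝕜 : Type v} [RCLike 𝕜]

/-- The manifold structure `A` turns the group `G` into a Lie group. -/
structure IsLieGroup {G : Type u} [Group G] (A : Smooth 𝕜 G) : Prop where
  mul : (A.prod A).Map A (fun p => p.1 * p.2)
  inv : A.Map A (fun x => x⁻¹)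

/-- `π : P → B` is a smooth principal bundle for the right action `(p, h) ↦ p * i h` of the Lie
group `H` on `P` which comes from a morphism of Lie groups `i : H → P`: the map `π` is a smooth
surjection whose fibres are the orbits, and `B` is covered by open sets `U` with a smooth section
`σ : U → P` for which `(b, h) ↦ σ b * i h` is a diffeomorphism `U × H → π ⁻¹ U`
(its inverse being `p ↦ (π p, τ p)`). -/
structure IsPrincipalBundle {H P B : Type u} [Group H] [Group P] (AH : Smooth 𝕜 H)
    (AP : Smooth 𝕜 P) (AB : Smooth 𝕜 B) (i : H →* P) (π : P → B) : Prop where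
  injective : Function.Injective i
  smooth_incl : AH.Map AP i
  smooth_proj : AP.Map AB π
  surjective : Function.Surjective π
  fibre : ∀ x y : P, π x = π y ↔ ∃ h : H, y = x * i h
  locally_trivial : ∀ b : B, ∃ U : Set B, AB.Open U ∧ b ∈ U ∧
    ∃ σ : B → P, AB.MapOn AP σ U ∧ (∀ x ∈ U, π (σ x) = x) ∧
    ∃ τ : P → H, AP.MapOn AH τ (π ⁻¹' U) ∧ ∀ y ∈ π ⁻¹' U, σ (π y) * i (τ y) = y

/-- `H` is a split Lie subgroup of the Lie group `G`, with Lie group structure `AH` on `H` and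
manifold structure `AQ` on the coset space `G ⧸ H`. -/
structure IsSplitLieSubgroup {G : Type u} [Group G] (AG : Smooth 𝕜 G) (H : Subgroup G)
    (AH : Smooth 𝕜 H) (AQ : Smooth 𝕜 (G ⧸ H)) : Prop where
  lie : IsLieGroup AH
  bundle : IsPrincipalBundle AH AG AQ H.subtype (fun x : G => (x : G ⧸ H))

/-- `1 → N → E → G → 1` is an extension of Lie groups: a short exact sequence of morphisms of Lie
groups for which `E` is a smooth `N`-principal bundle over `G`. -/
structure IsLieExtension {N E G : Type u} [Group N] [Group E] [Group G] (AN : Smooth 𝕜 N)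
    (AE : Smooth 𝕜 E) (AG : Smooth 𝕜 G) (ι : N →* E) (q : E →* G) : Prop where
  lie_left : IsLieGroup AN
  lie_mid : IsLieGroup AE
  lie_right : IsLieGroup AG
  exact : ι.range = q.ker
  bundle : IsPrincipalBundle AN AE AG ι q

/-- A Lie group extension of `G` by `N`. -/
structure LieExt {N G : Type u} [Group N] [Group G] (AG : Smooth 𝕜 G) (AN : Smooth 𝕜 N) where
  carrier : Type u
  [group : Group carrier]
  str : Smooth 𝕜 carrier
  ι : N →* carrier
  q : carrier →* G
  isExt : IsLieExtension AN str AG ι q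

attribute [instance] LieExt.group

/-- `φ` is an equivalence of the extensions `N → E₁ → G` and `N → E₂ → G`. -/
structure IsExtEquiv {N E₁ E₂ G : Type u} [Group N] [Group E₁] [Group E₂] [Group G]
    (A₁ : Smooth 𝕜 E₁) (A₂ : Smooth 𝕜 E₂) (ι₁ : N →* E₁) (q₁ : E₁ →* G) (ι₂ : N →* E₂)
    (q₂ : E₂ →* G) (φ : E₁ →* E₂) : Prop where
  smooth : A₁.Map A₂ φ
  comp_left : φ.comp ι₁ = ι₂
  comp_right : q₂.comp φ = q₁

namespace LieExt

variable {N G : Type u} [Group N] [Group G] {AG : Smooth 𝕜 G} {AN : Smooth 𝕜 N}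

/-- Equivalence of Lie group extensions. -/
def Equivalent (E₁ E₂ : LieExt AG AN) : Prop :=
  ∃ φ : E₁.carrier →* E₂.carrier, IsExtEquiv E₁.str E₂.str E₁.ι E₁.q E₂.ι E₂.q φ

theorem ι_injective (E : LieExt AG AN) : Function.Injective E.ι := E.isExt.bundle.injective

/-- The identification of `N` with the normal subgroup `ker q`. -/
noncomputable def kerEquiv (E : LieExt AG AN) : N ≃* E.q.ker :=
  (MonoidHom.ofInjective E.ι_injective).trans (MulEquiv.subgroupCongr E.isExt.exact)

/-- The conjugation representation `C_N` of an extension of `G` by `N` on `N`. -/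
noncomputable def conjN (E : LieExt AG AN) : E.carrier →* MulAut N :=
  (MulAut.congr E.kerEquiv.symm).toMonoidHom.comp MulAut.conjNormal

theorem ι_conjN (E : LieExt AG AN) (x : E.carrier) (n : N) :
    E.ι (E.conjN x n) = x * E.ι n * x⁻¹ := by
  have key : ∀ m : N, ((E.kerEquiv m : E.q.ker) : E.carrier) = E.ι m := fun m => rfl
  have h : E.conjN x n = E.kerEquiv.symm (MulAut.conjNormal x (E.kerEquiv n)) := rfl
  rw [h, ← key, MulEquiv.apply_symm_apply, MulAut.conjNormal_apply, key]

end LieExt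

/-! ### Locally smooth cochains, outer actions, kernels -/

variable {N G : Type u} [Group N] [Group G]

/-- `C^1_s(G,N)`: normalized maps which are smooth on an open identity neighbourhood. -/
def IsC1s (AG : Smooth 𝕜 G) (AN : Smooth 𝕜 N) (f : G → N) : Prop :=
  f 1 = 1 ∧ ∃ U : Set G, AG.Open U ∧ 1 ∈ U ∧ AG.MapOn AN f U

/-- `C^2_{ss}(G,N)`: normalized maps `ω` which are smooth on an open identity neighbourhood and
for which every map `ω_g : x ↦ ω(g, x) ω(g x g⁻¹, g)⁻¹` is smooth on an identity neighbourhood. -/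
structure IsC2ss (AG : Smooth 𝕜 G) (AN : Smooth 𝕜 N) (ω : G → G → N) : Prop where
  one_left : ∀ g, ω 1 g = 1
  one_right : ∀ g, ω g 1 = 1
  locally_smooth : ∃ U : Set (G × G), (AG.prod AG).Open U ∧ (1, 1) ∈ U ∧
    (AG.prod AG).MapOn AN (fun p => ω p.1 p.2) U
  strongly : ∀ g, ∃ U : Set G, AG.Open U ∧ 1 ∈ U ∧
    AG.MapOn AN (fun x => ω g x * (ω (g * x * g⁻¹) g)⁻¹) U

/-- `C^1_s(G, Aut(N))`: maps `S` from `G` to the group of Lie group automorphisms of `N` with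
`S(1) = id` for which `(g, n) ↦ S(g)(n)` is smooth on `U × N` for some open identity
neighbourhood `U`. -/
structure IsC1sAut (AG : Smooth 𝕜 G) (AN : Smooth 𝕜 N) (S : G → MulAut N) : Prop where
  diffeo : ∀ g, AN.Diffeo AN (S g).toEquiv
  one : S 1 = 1
  locally_smooth : ∃ U : Set G, AG.Open U ∧ 1 ∈ U ∧
    (AG.prod AN).MapOn AN (fun p => S p.1 p.2) (U ×ˢ univ)

/-- Strongly smooth outer actions of the Lie group `G` on the Lie group `N`: maps
`S ∈ C^1_s(G, Aut(N))` with `S(g) S(g') S(g g')⁻¹ = C_N(ω(g,g'))` for some `ω ∈ C^2_{ss}(G,N)`. -/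
structure OuterAction (AG : Smooth 𝕜 G) (AN : Smooth 𝕜 N) where
  toFun : G → MulAut N
  isC1sAut : IsC1sAut AG AN toFun
  exists_omega : ∃ ω : G → G → N, IsC2ss AG AN ω ∧
    ∀ g g', toFun g * toFun g' * (toFun (g * g'))⁻¹ = MulAut.conj (ω g g')

instance (AG : Smooth 𝕜 G) (AN : Smooth 𝕜 N) :
    CoeFun (OuterAction AG AN) (fun _ => G → MulAut N) := ⟨OuterAction.toFun⟩

/-- The relation `S ∼ S'`, i.e. `S' = (C_N ∘ h) · S` for some `h ∈ C^1_s(G,N)`. -/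
def SameKernel (AG : Smooth 𝕜 G) (AN : Smooth 𝕜 N) (S S' : G → MulAut N) : Prop :=
  ∃ h : G → N, IsC1s AG AN h ∧ ∀ g, S' g = MulAut.conj (h g) * S g

namespace LieExt

variable {AG : Smooth 𝕜 G} {AN : Smooth 𝕜 N}

/-- The extension `E` of `G` by `N` corresponds to the kernel `[S]`: for a locally smooth
normalized section `σ : G → E` of `q`, the map `C_N ∘ σ` is equivalent to `S`. -/
def CorrespondsTo (E : LieExt AG AN) (S : G → MulAut N) : Prop :=
  ∃ σ : G → E.carrier, IsC1s AG E.str σ ∧ (∀ g, E.q (σ g) = g) ∧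
    SameKernel AG AN S (fun g => E.conjN (σ g))

variable (AG AN) in
/-- The Lie group extensions of `G` by `N` corresponding to `[S]`. -/
def WithKernel (S : G → MulAut N) : Type (max (u + 1) v) :=
  {E : LieExt AG AN // E.CorrespondsTo S}

variable (AG AN) in
/-- `Ext(G,N)_{[S]}`: equivalence classes of Lie group extensions of `G` by `N` corresponding to
`[S]`. -/
def Ext (S : G → MulAut N) : Type (max (u + 1) v) :=
  Quot (fun E₁ E₂ : WithKernel AG AN S => Equivalent E₁.1 E₂.1)

end LieExt

/-! ### The group `G^S` -/

variable (N) in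
/-- The adjoint group `N_ad = N / Z(N)`. -/
abbrev Nad : Type u := N ⧸ Subgroup.center N

theorem ker_conj : (MulAut.conj : N →* MulAut N).ker = Subgroup.center N := by
  ext z
  rw [MonoidHom.mem_ker, Subgroup.mem_center_iff]
  constructor
  · intro h n
    have := DFunLike.congr_fun h n
    simp only [MulAut.conj_apply, MulAut.one_apply] at this
    rw [mul_inv_eq_iff_eq_mul] at this
    exact this.symm
  · intro h
    ext n
    simp only [MulAut.conj_apply, MulAut.one_apply]
    rw [mul_inv_eq_iff_eq_mul, h n]

variable (N) in
/-- The isomorphism `N_ad ≅ C_N(N)`, `n Z(N) ↦ C_N(n)`. -/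
noncomputable def adIso : Nad N ≃* (MulAut.conj : N →* MulAut N).range :=
  (QuotientGroup.quotientMulEquivOfEq ker_conj.symm).trans
    (QuotientGroup.quotientKerEquivRange (MulAut.conj : N →* MulAut N))

variable (N) in
/-- The faithful representation `N_ad → Aut(N)`, `n Z(N) ↦ C_N(n)`. -/
noncomputable def ad : Nad N →* MulAut N :=
  (MulAut.conj : N →* MulAut N).range.subtype.comp (adIso N).toMonoidHom

theorem ad_mk (n : N) : ad N (n : Nad N) = MulAut.conj n := rfl

theorem ad_injective : Function.Injective (ad N) :=
  Subtype.val_injective.comp (adIso N).injective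

theorem ad_mem (a : Nad N) : ad N a ∈ (MulAut.conj : N →* MulAut N).range := (adIso N a).2

theorem ad_adIso_symm (φ : (MulAut.conj : N →* MulAut N).range) :
    ad N ((adIso N).symm φ) = φ := by
  change ((adIso N ((adIso N).symm φ) : (MulAut.conj : N →* MulAut N).range) : MulAut N) = φ
  rw [MulEquiv.apply_symm_apply]

theorem conj_range_normal (φ ψ : MulAut N) (h : ψ ∈ (MulAut.conj : N →* MulAut N).range) :
    φ * ψ * φ⁻¹ ∈ (MulAut.conj : N →* MulAut N).range := by
  obtain ⟨n, rfl⟩ := h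
  refine ⟨φ n, ?_⟩
  ext x
  simp [MulAut.conj_apply]

variable {AG : Smooth 𝕜 G} {AN : Smooth 𝕜 N}

namespace OuterAction

/-- `δ_S(g,g') = S(g) S(g') S(g g')⁻¹`. -/
def delta (S : OuterAction AG AN) (g g' : G) : MulAut N := S g * S g' * (S (g * g'))⁻¹

theorem delta_mem (S : OuterAction AG AN) (g g' : G) :
    S.delta g g' ∈ (MulAut.conj : N →* MulAut N).range := by
  obtain ⟨ω, -, h⟩ := S.exists_omega
  exact ⟨ω g g', (h g g').symm⟩

end OuterAction

/-- The set underlying `G^S`, namely `N_ad × G`. -/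
@[ext]
structure GS (S : OuterAction AG AN) where
  fst : Nad N
  snd : G

namespace GS

variable {S : OuterAction AG AN}

/-- The first component of the product of two elements of `G^S`, in `C_N(N) ≅ N_ad`:
`(C_N(n), g) (C_N(n'), g') = (C_N(n) S(g) C_N(n') S(g)⁻¹ δ_S(g,g'), g g')`. -/
theorem mul_mem (x y : GS S) :
    ad N x.fst * (S x.snd * ad N y.fst * (S x.snd)⁻¹) * S.delta x.snd y.snd ∈
      (MulAut.conj : N →* MulAut N).range :=
  Subgroup.mul_mem _ (Subgroup.mul_mem _ (ad_mem _) (conj_range_normal _ _ (ad_mem _))) (S.delta_mem _ _)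

theorem inv_mem (x : GS S) :
    ((S x.snd)⁻¹ * (ad N x.fst)⁻¹ * (S x.snd)⁻¹⁻¹) * (S.delta x.snd⁻¹ x.snd)⁻¹ ∈
      (MulAut.conj : N →* MulAut N).range :=
  Subgroup.mul_mem _ (conj_range_normal _ _ (Subgroup.inv_mem _ (ad_mem _)))
    (Subgroup.inv_mem _ (S.delta_mem _ _))

noncomputable instance : Mul (GS S) :=
  ⟨fun x y => ⟨(adIso N).symm ⟨_, mul_mem x y⟩, x.snd * y.snd⟩⟩

noncomputable instance : One (GS S) := ⟨⟨1, 1⟩⟩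

noncomputable instance : Inv (GS S) :=
  ⟨fun x => ⟨(adIso N).symm ⟨_, inv_mem x⟩, x.snd⁻¹⟩⟩

theorem ad_mul_fst (x y : GS S) : ad N (x * y).fst =
    ad N x.fst * (S x.snd * ad N y.fst * (S x.snd)⁻¹) * S.delta x.snd y.snd :=
  ad_adIso_symm ⟨_, mul_mem x y⟩

theorem mul_snd (x y : GS S) : (x * y).snd = x.snd * y.snd := rfl

theorem one_fst : (1 : GS S).fst = 1 := rfl

theorem one_snd : (1 : GS S).snd = 1 := rfl

theorem ad_inv_fst (x : GS S) : ad N (x⁻¹).fst =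
    ((S x.snd)⁻¹ * (ad N x.fst)⁻¹ * (S x.snd)⁻¹⁻¹) * (S.delta x.snd⁻¹ x.snd)⁻¹ :=
  ad_adIso_symm ⟨_, inv_mem x⟩

theorem inv_snd (x : GS S) : (x⁻¹).snd = x.snd⁻¹ := rfl

/-- The underlying function of `ρ`. -/
noncomputable def rhoFun (x : GS S) : MulAut N := ad N x.fst * S x.snd

theorem rhoFun_mul (x y : GS S) : rhoFun (x * y) = rhoFun x * rhoFun y := by
  simp only [rhoFun, ad_mul_fst, mul_snd, OuterAction.delta]
  group

theorem rhoFun_one : rhoFun (1 : GS S) = 1 := by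
  simp [rhoFun, one_fst, one_snd, S.isC1sAut.one]

theorem rhoFun_inv_mul (x : GS S) : rhoFun x⁻¹ * rhoFun x = 1 := by
  simp only [rhoFun, ad_inv_fst, inv_snd, OuterAction.delta, inv_mul_cancel, S.isC1sAut.one]
  group

theorem ext_rho {x y : GS S} (h : rhoFun x = rhoFun y) (h' : x.snd = y.snd) : x = y := by
  refine GS.ext (ad_injective ?_) h'
  simpa [rhoFun, h'] using h

noncomputable instance : Group (GS S) :=
  Group.ofLeftAxioms
    (fun x y z => ext_rho (by simp only [rhoFun_mul, mul_assoc])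
      (by simp only [mul_snd, mul_assoc]))
    (fun x => ext_rho (by rw [rhoFun_mul, rhoFun_one, one_mul])
      (by rw [mul_snd, one_snd, one_mul]))
    (fun x => ext_rho (by rw [rhoFun_mul, rhoFun_inv_mul, rhoFun_one])
      (by rw [mul_snd, inv_snd, one_snd, inv_mul_cancel]))

/-- The product of `G^S` in terms of any `ω` with `δ_S = C_N ∘ ω`. -/
theorem mk_mul_mk {ω : G → G → N} (hω : ∀ g g', S.delta g g' = MulAut.conj (ω g g'))
    (n n' : N) (g g' : G) :
    (⟨(n : Nad N), g⟩ * ⟨(n' : Nad N), g'⟩ : GS S) =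
      ⟨((n * S g n' * ω g g' : N) : Nad N), g * g'⟩ := by
  refine GS.ext (ad_injective ?_) rfl
  rw [ad_mul_fst]
  simp only [ad_mk, hω, map_mul]
  congr 2
  ext x
  simp [MulAut.conj_apply]

variable (S)

/-- The action `ρ : G^S → Aut(N)`, `(C_N(n), g) ↦ C_N(n) S(g)`. -/
noncomputable def rho : GS S →* MulAut N where
  toFun := rhoFun
  map_one' := rhoFun_one
  map_mul' := rhoFun_mul

/-- The action of `G^S` on `Z(N)` obtained from `ρ` by restriction. -/
noncomputable def rhoZ : GS S →* MulAut (Subgroup.center N) where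
  toFun x := Subgroup.centerCongr (rho S x)
  map_one' := by
    rw [map_one]
    rfl
  map_mul' x y := by
    rw [map_mul]
    rfl

theorem rhoZ_apply (x : GS S) (z : Subgroup.center N) :
    ((rhoZ S x z : Subgroup.center N) : N) = rho S x (z : N) := rfl

/-- The projection `q_S : G^S → G`. -/
def proj : GS S →* G where
  toFun x := x.snd
  map_one' := rfl
  map_mul' _ _ := rfl

/-- The inclusion `N_ad → G^S`, `C_N(n) ↦ (C_N(n), 1)`. -/
noncomputable def incl : Nad N →* GS S where
  toFun a := ⟨a, 1⟩
  map_one' := rfl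
  map_mul' a b := ext_rho (by rw [rhoFun_mul]; simp [rhoFun, S.isC1sAut.one]) (by simp [mul_snd])

/-- The injection `G^S = C_N(N) × G → Aut(N) × G`. -/
noncomputable def toAutProd (x : GS S) : MulAut N × G := (ad N x.fst, x.snd)

/-- The manifold structure `L` on `G^S` is the natural one: it is a Lie group structure for which,
for some open identity neighbourhood `U` of `G`, the identity map
`N_ad × U → q_S⁻¹(U) ⊆ G^S` is a diffeomorphism onto an open subset. -/
structure IsNatural (Aad : Smooth 𝕜 (Nad N)) (L : Smooth 𝕜 (GS S)) : Prop where
  lie : IsLieGroup L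
  product : ∃ U : Set G, AG.Open U ∧ 1 ∈ U ∧ L.Open (proj S ⁻¹' U) ∧
    (Aad.prod AG).MapOn L (fun p => ⟨p.1, p.2⟩) (univ ×ˢ U) ∧
    L.MapOn (Aad.prod AG) (fun x => (x.fst, x.snd)) (proj S ⁻¹' U)

end GS

namespace LieExt

/-- The map `γ = (C_N · (S ∘ q)⁻¹, q) : E → Aut(N) × G` of an extension `E` of `G` by `N`. -/
noncomputable def gammaMap (S : OuterAction AG AN) (E : LieExt AG AN) (x : E.carrier) :
    MulAut N × G :=
  (E.conjN x * (S (E.q x))⁻¹, E.q x)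

/-- The image of `Z(N)` in an extension of `G` by `N`. -/
def centerImage (E : LieExt AG AN) : Subgroup E.carrier := (Subgroup.center N).map E.ι

instance (E : LieExt AG AN) : E.centerImage.Normal where
  conj_mem := by
    rintro _ ⟨z, hz, rfl⟩ x
    refine ⟨E.conjN x z, ?_, E.ι_conjN x z⟩
    exact (Subgroup.centerCongr (E.conjN x) ⟨z, hz⟩).2

/-- A homomorphism `γ : E → G^S` defines an extension of `G^S` by `Z(N)` with total group `E`. -/
abbrev overGS {S : OuterAction AG AN} {L : Smooth 𝕜 (GS S)} {AZ : Smooth 𝕜 (Subgroup.center N)}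
    (E : LieExt AG AN) (γ : E.carrier →* GS S)
    (h : IsLieExtension AZ E.str L (E.ι.comp (Subgroup.center N).subtype) γ) : LieExt L AZ where
  carrier := E.carrier
  str := E.str
  ι := E.ι.comp (Subgroup.center N).subtype
  q := γ
  isExt := h

variable {S : OuterAction AG AN} {L : Smooth 𝕜 (GS S)} {AZ : Smooth 𝕜 (Subgroup.center N)}

/-- For an extension `γ : F → G^S` by `Z(N)`, the subgroup `γ⁻¹(N_ad)` of `F`. -/
noncomputable def preNad (F : LieExt L AZ) : Subgroup F.carrier := (GS.incl S).range.comap F.q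

/-- The inclusion `Z(N) → γ⁻¹(N_ad)`. -/
noncomputable def preNadι (F : LieExt L AZ) : Subgroup.center N →* F.preNad :=
  F.ι.codRestrict F.preNad (fun z => by
    have h : F.ι z ∈ F.q.ker := F.isExt.exact ▸ ⟨z, rfl⟩
    refine ⟨1, ?_⟩
    rw [map_one, (MonoidHom.mem_ker).1 h])

theorem preNad_snd (F : LieExt L AZ) (x : F.preNad) : (F.q x).snd = 1 := by
  obtain ⟨a, ha⟩ := x.2
  rw [← ha]; rfl

/-- The projection `γ⁻¹(N_ad) → N_ad` obtained from `γ` by restriction. -/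
noncomputable def preNadProj (F : LieExt L AZ) : F.preNad →* Nad N where
  toFun x := (F.q x).fst
  map_one' := by simp [GS.one_fst]
  map_mul' x y := by
    apply ad_injective
    simp [GS.ad_mul_fst, preNad_snd, S.isC1sAut.one, OuterAction.delta]

/-- There is a `G^S`-equivariant equivalence `α : N → γ⁻¹(N_ad) ⊆ F` of central extensions of
`N_ad` by `Z(N)`. Here `γ⁻¹(N_ad)` is considered with its structure of a split Lie subgroup of
`F`, and `γ(x) ∈ G^S` acts on it by conjugation with `x ∈ F`. -/
def HasEquivariantEquiv (AN : Smooth 𝕜 N) {S : OuterAction AG AN} {L : Smooth 𝕜 (GS S)}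
    {AZ : Smooth 𝕜 (Subgroup.center N)} (Aad : Smooth 𝕜 (Nad N)) (F : LieExt L AZ) : Prop :=
  ∃ (P : Smooth 𝕜 F.preNad) (Q : Smooth 𝕜 (F.carrier ⧸ F.preNad)),
    IsSplitLieSubgroup F.str F.preNad P Q ∧
    IsLieExtension AZ P Aad F.preNadι F.preNadProj ∧
    F.preNadι.range ≤ Subgroup.center F.preNad ∧
    ∃ α : N →* F.preNad,
      IsExtEquiv AN P (Subgroup.center N).subtype (QuotientGroup.mk' (Subgroup.center N))
        F.preNadι F.preNadProj α ∧
      ∀ (x : F.carrier) (n : N),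
        (α (GS.rho S (F.q x) n) : F.carrier) = x * (α n : F.carrier) * x⁻¹

end LieExt

end LieGroups

end LCLie

/-! An element `x` of `G^S` is determined by the pair `(ρ(x), q_S(x))`, and both components are
homomorphisms. If an extension `E` of `G` by `N` corresponds to `[S]`, every `x ∈ E` has the form
`ι(n) σ(q x)`, so `C_N(x)` differs from `S(q x)` by an inner automorphism. Hence there is exactly
one map `γ : E → G^S` with `ρ ∘ γ = C_N` and `q_S ∘ γ = q`. Uniqueness makes it a homomorphism
compatible with equivalences; its kernel is `ι(Z(N))` and the preimage of `N_ad` is `ι(N)`.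

Conversely, let `F` be an extension of `G^S` by `Z(N)`. An equivariant equivalence of `N` with the
preimage of `N_ad` makes `F` an extension of `G` by `N` with projection `q_S ∘ γ`. Equivariance says
precisely that `C_N = ρ ∘ γ`, so by uniqueness `γ` is the map attached to this extension, and `F`
lies in the image of `τ` (`exists_equivalent_of_hasEquivariantEquiv`).

The Lie group structure on `G^S` comes from local data (`LocalLieGroup`): the product structure on
`N_ad × U` is spread over the group by left translations. Smoothness of multiplication and inversion
near `1` follows from local smoothness of `S` and `ω`; smoothness of conjugations at `1` is what the
second condition in `C^2_{ss}` supplies.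

Two devices handle the remaining smoothness. A homomorphism smooth at `1` is smooth, and the
structure group of a principal bundle is initial in the total space. Consequently a short exact
sequence with initial kernel and a section smooth at `1` is a Lie group extension
(`IsLieExtension.of_section`), and equivalences are invertible (`IsLieExtension.exists_mulEquiv`).
Composing smooth maps rests on the chain rule, which is derived from a Hahn–Banach form of the mean
value theorem. -/

namespace LCLie

/-! ### The chain rule -/

/-- Hausdorff locally convex spaces over `𝕜`. -/
class LCSpace (𝕜 : Type v) [RCLike 𝕜] (E : Type u) [AddCommGroup E] [Module 𝕜 E]
    [TopologicalSpace E] : Prop extends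
    IsTopologicalAddGroup E, ContinuousSMul 𝕜 E, T2Space E where
  locConvex : @LocallyConvexSpace ℝ E _ _ _ (Module.compHom E (algebraMap ℝ 𝕜)) _

instance {𝕜 : Type v} [RCLike 𝕜] {E F : Type u} [AddCommGroup E] [Module 𝕜 E]
    [TopologicalSpace E] [AddCommGroup F] [Module 𝕜 F] [TopologicalSpace F] [LCSpace 𝕜 E]
    [LCSpace 𝕜 F] : LCSpace 𝕜 (E × F) where
  locConvex := by
    let _ : Module ℝ E := Module.compHom E (algebraMap ℝ 𝕜)
    let _ : Module ℝ F := Module.compHom F (algebraMap ℝ 𝕜)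
    have _ : LocallyConvexSpace ℝ E := LCSpace.locConvex (𝕜 := 𝕜)
    have _ : LocallyConvexSpace ℝ F := LCSpace.locConvex (𝕜 := 𝕜)
    exact (inferInstance : LocallyConvexSpace ℝ (E × F))

instance {𝕜 : Type v} [RCLike 𝕜] {M : Type u} (A : Smooth 𝕜 M) : LCSpace 𝕜 A.Model where
  locConvex := A.locConvex

/-! ### Directional derivatives and the mean value theorem -/

section DirectionalDerivative

variable {𝕜 : Type v} [RCLike 𝕜] {E F : Type u} [AddCommGroup E] [Module 𝕜 E]
  [AddCommGroup F] [Module 𝕜 F] [TopologicalSpace F]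

/-- The directional derivatives of a map between topological vector spaces. -/
noncomputable def dirDeriv (𝕜 : Type v) [RCLike 𝕜] [Module 𝕜 E] [Module 𝕜 F] (f : E → F)
    (p : E × E) : F :=
  @limUnder _ _ _ ⟨0⟩ (𝓝[≠] (0 : 𝕜)) (fun t : 𝕜 => t⁻¹ • (f (p.1 + t • p.2) - f p.1))

theorem dirDeriv_eq [T2Space F] {f : E → F} {x h : E} {y : F}
    (hd : Tendsto (fun t : 𝕜 => t⁻¹ • (f (x + t • h) - f x)) (𝓝[≠] 0) (𝓝 y)) :
    dirDeriv 𝕜 f (x, h) = y :=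
  hd.limUnder_eq

/-- Mean value theorem in locally convex form. Were the difference quotient outside `C`, a
continuous real functional would separate it strictly from `C`; the scalar mean value theorem on the
segment then yields a derivative outside `C`. -/
theorem diffQuot_mem [LCSpace 𝕜 F] [Module ℝ F] [ContinuousSMul ℝ F] [LocallyConvexSpace ℝ F]
    (hsm : ∀ (r : ℝ) (y : F), r • y = (algebraMap ℝ 𝕜 r) • y)
    {f : E → F} {df : E × E → F} {C : Set F} (hC : Convex ℝ C) (hC' : IsClosed C) {x h : E}
    {t : 𝕜} (ht : t ≠ 0)
    (hd : ∀ s ∈ Icc (0 : ℝ) 1, Tendsto (fun r : 𝕜 => r⁻¹ • (f (x + ((s : 𝕜) * t) • h + r • h) -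
      f (x + ((s : 𝕜) * t) • h))) (𝓝[≠] 0) (𝓝 (df (x + ((s : 𝕜) * t) • h, h))))
    (hm : ∀ s ∈ Icc (0 : ℝ) 1, df (x + ((s : 𝕜) * t) • h, h) ∈ C) :
    t⁻¹ • (f (x + t • h) - f x) ∈ C := by
  by_contra hn
  obtain ⟨l, u, hl, hu⟩ := geometric_hahn_banach_closed_point hC hC' hn
  -- The factor `t⁻¹` cancels the inner derivative `t`, so that `ψ' = l ∘ df` along the segment and
  -- `ψ 1 - ψ 0` is `l` of the difference quotient.
  let ψ : ℝ → ℝ := fun s => l (t⁻¹ • f (x + ((s : 𝕜) * t) • h))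
  have hψ : ∀ s ∈ Icc (0 : ℝ) 1, HasDerivAt ψ (l (df (x + ((s : 𝕜) * t) • h, h))) s := by
    intro s hs
    rw [hasDerivAt_iff_tendsto_slope_zero]
    have h1 : Tendsto (fun r : ℝ => (r : 𝕜) * t) (𝓝[≠] 0) (𝓝[≠] 0) := by
      refine tendsto_nhdsWithin_of_tendsto_nhds_of_eventually_within _ ?_ ?_
      · have : Continuous fun r : ℝ => (r : 𝕜) * t := by fun_prop
        exact (this.tendsto' 0 0 (by simp)).mono_left nhdsWithin_le_nhds
      · filter_upwards [self_mem_nhdsWithin] with r hr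
        have hr : r ≠ 0 := hr
        simp [hr, ht]
    refine ((l.continuous.tendsto _).comp ((hd s hs).comp h1)).congr' ?_
    filter_upwards [self_mem_nhdsWithin] with r hr
    have hr : r ≠ 0 := hr
    simp only [Function.comp_apply, ψ, ← map_sub, ← map_smul]
    rw [hsm, ← smul_sub, smul_smul, add_assoc, ← add_smul, ← add_mul]
    congr 2
    · simp [mul_comm]
    · simp
  obtain ⟨s, hs, hs'⟩ := exists_hasDerivAt_eq_slope ψ _ zero_lt_one
    (fun s hs => (hψ s hs).continuousAt.continuousWithinAt)
    (fun s hs => hψ s (Ioo_subset_Icc_self hs))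
  have h2 := hl _ (hm s (Ioo_subset_Icc_self hs))
  rw [hs'] at h2
  simp only [ψ, RCLike.ofReal_one, one_mul, RCLike.ofReal_zero, zero_mul, zero_smul, add_zero,
    sub_zero, div_one, ← map_sub, ← smul_sub] at h2
  exact lt_asymm h2 hu

end DirectionalDerivative

/-! ### Locality of `C^n` maps and composition -/

section Calculus

variable {𝕜 : Type v} [RCLike 𝕜] {E F : Type u}
  [AddCommGroup E] [Module 𝕜 E] [TopologicalSpace E]
  [AddCommGroup F] [Module 𝕜 F] [TopologicalSpace F]

theorem IsCn.continuousOn {n : ℕ} {f : E → F} {U : Set E} (h : IsCn 𝕜 n f U) :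
    ContinuousOn f U := by
  cases n with
  | zero => exact h
  | succ n => exact h.1

theorem IsCn.of_succ {n : ℕ} : ∀ {E F : Type u}
    [AddCommGroup E] [Module 𝕜 E] [TopologicalSpace E]
    [AddCommGroup F] [Module 𝕜 F] [TopologicalSpace F] {f : E → F} {U : Set E},
    IsCn 𝕜 (n + 1) f U → IsCn 𝕜 n f U := by
  induction n with
  | zero => intro E F _ _ _ _ _ _ f U h; exact h.1
  | succ n ih =>
    intro E F _ _ _ _ _ _ f U h
    obtain ⟨hc, df, hd, hdf⟩ := h
    exact ⟨hc, df, hd, ih hdf⟩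

theorem IsCn.const (n : ℕ) : ∀ {E F : Type u}
    [AddCommGroup E] [Module 𝕜 E] [TopologicalSpace E]
    [AddCommGroup F] [Module 𝕜 F] [TopologicalSpace F] (c : F) (U : Set E),
    IsCn 𝕜 n (fun _ => c) U := by
  induction n with
  | zero => intro E F _ _ _ _ _ _ c U; exact continuousOn_const
  | succ n ih =>
    intro E F _ _ _ _ _ _ c U
    exact ⟨continuousOn_const, fun _ => 0, fun x _ h => by simpa using tendsto_const_nhds, ih 0 _⟩

theorem eventually_add_smul_mem [ContinuousAdd E] [ContinuousSMul 𝕜 E] {U : Set E} (hU : IsOpen U)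
    {x : E} (hx : x ∈ U) (h : E) : ∀ᶠ t : 𝕜 in 𝓝[≠] 0, x + t • h ∈ U := by
  have hc : Continuous fun t : 𝕜 => x + t • h := by fun_prop
  exact nhdsWithin_le_nhds (hc.continuousAt.preimage_mem_nhds (by simpa using hU.mem_nhds hx))

theorem IsCn.congr {n : ℕ} [ContinuousAdd E] [ContinuousSMul 𝕜 E] {f g : E → F} {U : Set E}
    (hU : IsOpen U) (hf : IsCn 𝕜 n f U) (hfg : EqOn f g U) : IsCn 𝕜 n g U := by
  cases n with
  | zero => exact ContinuousOn.congr (f := f) hf hfg.symm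
  | succ n =>
    obtain ⟨hc, df, hd, hdf⟩ := hf
    refine ⟨hc.congr hfg.symm, df, fun x hx h => (hd x hx h).congr' ?_, hdf⟩
    filter_upwards [eventually_add_smul_mem hU hx h] with t ht
    rw [hfg hx, hfg ht]

/-- The local derivatives are given only existentially. Limits in the Hausdorff space `F` are
unique, so each agrees with `dirDeriv`, which therefore glues them. -/
theorem IsCn.of_locally {n : ℕ} : ∀ {E F : Type u}
    [AddCommGroup E] [Module 𝕜 E] [TopologicalSpace E]
    [AddCommGroup F] [Module 𝕜 F] [TopologicalSpace F] [ContinuousAdd E] [ContinuousSMul 𝕜 E]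
    [T2Space F] {f : E → F} {U : Set E},
    (∀ x ∈ U, ∃ V, IsOpen V ∧ x ∈ V ∧ IsCn 𝕜 n f V) → IsCn 𝕜 n f U := by
  induction n with
  | zero =>
    intro E F _ _ _ _ _ _ _ _ _ f U h x hx
    obtain ⟨V, hV, hxV, hf⟩ := h x hx
    exact (ContinuousOn.continuousAt hf (hV.mem_nhds hxV)).continuousWithinAt
  | succ n ih =>
    intro E F _ _ _ _ _ _ _ _ _ f U h
    refine ⟨fun x hx => ?_, dirDeriv 𝕜 f, fun x hx k => ?_, ih ?_⟩
    · obtain ⟨V, hV, hxV, hf⟩ := h x hx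
      exact (hf.continuousOn.continuousAt (hV.mem_nhds hxV)).continuousWithinAt
    · obtain ⟨V, hV, hxV, hc, df, hd, hdf⟩ := h x hx
      rw [dirDeriv_eq (hd x hxV k)]
      exact hd x hxV k
    · rintro ⟨x, k⟩ ⟨hx, -⟩
      obtain ⟨V, hV, hxV, hc, df, hd, hdf⟩ := h x hx
      exact ⟨V ×ˢ univ, hV.prod isOpen_univ, ⟨hxV, mem_univ _⟩,
        hdf.congr (hV.prod isOpen_univ) fun p hp => (dirDeriv_eq (hd p.1 hp.1 p.2)).symm⟩

/-- The direction may vary with `t`: this is what the chain rule needs. Near `(x, k₀)` the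
derivative stays in a small convex set, and the mean value theorem puts the difference quotient into
its closure. -/
theorem tendsto_diffQuot [LCSpace 𝕜 E] [LCSpace 𝕜 F] {f : E → F} {df : E × E → F} {U : Set E}
    (hU : IsOpen U)
    (hd : ∀ x ∈ U, ∀ h : E, Tendsto (fun t : 𝕜 => t⁻¹ • (f (x + t • h) - f x)) (𝓝[≠] 0)
          (𝓝 (df (x, h)))) (hdf : ContinuousOn df (U ×ˢ univ)) {x : E} (hx : x ∈ U) {k₀ : E}
    {k : 𝕜 → E} (hk : Tendsto k (𝓝[≠] 0) (𝓝 k₀)) :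
    Tendsto (fun t : 𝕜 => t⁻¹ • (f (x + t • k t) - f x)) (𝓝[≠] 0) (𝓝 (df (x, k₀))) := by
  let _ : Module ℝ F := Module.compHom F (algebraMap ℝ 𝕜)
  have _ : LocallyConvexSpace ℝ F := LCSpace.locConvex (𝕜 := 𝕜)
  have _ : ContinuousSMul ℝ F := ⟨by
    have h1 : Continuous fun p : ℝ × F => (algebraMap ℝ 𝕜 p.1) • p.2 :=
      ((RCLike.continuous_ofReal (K := 𝕜)).comp continuous_fst).smul continuous_snd
    exact h1⟩
  rw [(nhds_basis_opens _).tendsto_right_iff]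
  rintro O ⟨hxO, hO⟩
  -- The mean value argument needs a closed convex set: take a closed neighbourhood inside `O` by
  -- regularity, then a convex neighbourhood `C` inside that one.
  obtain ⟨O', hO', hO'c, hO'O⟩ := exists_mem_nhds_isClosed_subset (hO.mem_nhds hxO)
  obtain ⟨C, ⟨hCn, hC⟩, hCO⟩ :=
    (LocallyConvexSpace.convex_basis (𝕜 := ℝ) (df (x, k₀))).mem_iff.1 hO'
  have hcl : closure C ⊆ O := (closure_minimal hCO hO'c).trans hO'O
  have hc1 : ContinuousAt df (x, k₀) :=
    hdf.continuousAt ((hU.prod isOpen_univ).mem_nhds ⟨hx, mem_univ _⟩)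
  have hc2 : Continuous fun p : 𝕜 × E => (x + p.1 • p.2, p.2) := by fun_prop
  have h1 : ∀ᶠ p : 𝕜 × E in 𝓝 (0, k₀), df (x + p.1 • p.2, p.2) ∈ C ∧ x + p.1 • p.2 ∈ U := by
    have h2 : ∀ᶠ q : E × E in 𝓝 (x, k₀), df q ∈ C ∧ q.1 ∈ U :=
      (hc1.eventually_mem hCn).and
        (continuous_fst.continuousAt.eventually_mem (hU.mem_nhds hx))
    exact (hc2.tendsto' (0, k₀) (x, k₀) (by simp)).eventually h2
  rw [nhds_prod_eq, eventually_prod_iff] at h1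
  obtain ⟨p, hp, q, hq, hpq⟩ := h1
  obtain ⟨ε, hε, hball⟩ := Metric.eventually_nhds_iff_ball.1 hp
  have h3 : ∀ᶠ t : 𝕜 in 𝓝[≠] 0, t ∈ Metric.ball (0 : 𝕜) ε :=
    nhdsWithin_le_nhds (Metric.ball_mem_nhds _ hε)
  filter_upwards [h3, hk.eventually hq, self_mem_nhdsWithin] with t ht hqt ht0
  have h4 : ∀ s ∈ Icc (0 : ℝ) 1, df (x + ((s : 𝕜) * t) • k t, k t) ∈ C ∧
      x + ((s : 𝕜) * t) • k t ∈ U := by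
    intro s hs
    refine hpq (hball _ ?_) hqt
    rw [mem_ball_zero_iff] at ht ⊢
    rw [norm_mul, RCLike.norm_ofReal, abs_of_nonneg hs.1]
    exact (mul_le_of_le_one_left (norm_nonneg _) hs.2).trans_lt ht
  exact hcl (diffQuot_mem (𝕜 := 𝕜) (fun _ _ => rfl) hC.closure isClosed_closure ht0
    (fun s hs => hd _ (h4 s hs).2 _) fun s hs => subset_closure (h4 s hs).1)

/-- Write `f (x + t h) = f x + t k(t)`, where `k(t)` is the difference quotient of `f`, and apply
`tendsto_diffQuot` to `g`. The derivative is `dg` composed with `(f, df)`, which is `C^n`, so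
induction applies. -/
theorem IsCn.comp {n : ℕ} : ∀ {E F G : Type u}
    [AddCommGroup E] [Module 𝕜 E] [TopologicalSpace E]
    [AddCommGroup F] [Module 𝕜 F] [TopologicalSpace F]
    [AddCommGroup G] [Module 𝕜 G] [TopologicalSpace G]
    [LCSpace 𝕜 E] [LCSpace 𝕜 F] [LCSpace 𝕜 G] {g : F → G} {f : E → F} {U : Set E} {V : Set F},
    IsOpen U → IsOpen V → IsCn 𝕜 n g V → IsCn 𝕜 n f U → MapsTo f U V →
    IsCn 𝕜 n (fun x => g (f x)) U := by
  induction n with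
  | zero =>
    intro E F G _ _ _ _ _ _ _ _ _ _ _ _ g f U V hU hV hg hf hm
    exact ContinuousOn.comp (g := g) (f := f) hg hf hm
  | succ n ih =>
    intro E F G _ _ _ _ _ _ _ _ _ _ _ _ g f U V hU hV hg hf hm
    have hf' := hf.of_succ
    obtain ⟨hc, df, hd, hdf⟩ := hf
    obtain ⟨hc', dg, hd', hdg⟩ := hg
    refine ⟨hc'.comp hc hm, fun p => dg (f p.1, df p), fun x hx h => ?_, ?_⟩
    · refine (tendsto_diffQuot hV hd' hdg.continuousOn (hm hx) (hd x hx h)).congr' ?_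
      filter_upwards [self_mem_nhdsWithin] with t ht
      have ht : t ≠ 0 := ht
      rw [smul_smul, mul_inv_cancel₀ ht, one_smul, add_sub_cancel]
    · refine ih (hU.prod isOpen_univ) (hV.prod isOpen_univ) hdg
        (((hf'.comp_clm (ContinuousLinearMap.fst 𝕜 E E)).mono fun _ h => h.1).prodMk hdf) ?_
      exact fun p hp => ⟨hm hp.1, mem_univ _⟩

end Calculus
/-! ### Smoothness at a point -/

namespace Smooth

variable {𝕜 : Type v} [RCLike 𝕜] {M M' P : Type u} {A : Smooth 𝕜 M} {B : Smooth 𝕜 M'}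
  {C : Smooth 𝕜 P}

/-- The neighbourhood filter of a point of a manifold. -/
def nhds (A : Smooth 𝕜 M) (x : M) : Filter M := @_root_.nhds M A.top x

theorem Open.mem_nhds {U : Set M} (hU : A.Open U) {x : M} (hx : x ∈ U) : U ∈ A.nhds x :=
  letI := A.top
  IsOpen.mem_nhds hU hx

theorem mem_nhds_iff {U : Set M} {x : M} : U ∈ A.nhds x ↔ ∃ V ⊆ U, A.Open V ∧ x ∈ V :=
  letI := A.top
  _root_.mem_nhds_iff

theorem nhds_prod (A : Smooth 𝕜 M) (B : Smooth 𝕜 M') (x : M) (y : M') :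
    (A.prod B).nhds (x, y) = A.nhds x ×ˢ B.nhds y :=
  letI := A.top; letI := B.top
  nhds_prod_eq

theorem Open.prod {U : Set M} {V : Set M'} (hU : A.Open U) (hV : B.Open V) :
    (A.prod B).Open (U ×ˢ V) :=
  letI := A.top; letI := B.top
  IsOpen.prod hU hV

theorem open_univ (A : Smooth 𝕜 M) : A.Open univ :=
  letI := A.top
  isOpen_univ

theorem Open.inter {U V : Set M} (hU : A.Open U) (hV : A.Open V) : A.Open (U ∩ V) :=
  letI := A.top
  IsOpen.inter hU hV

theorem open_iff {U : Set M} : A.Open U ↔ ∀ x ∈ U, U ∈ A.nhds x :=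
  letI := A.top
  isOpen_iff_mem_nhds

/-- The map `f` is smooth on an open neighbourhood of `x`. -/
def SmoothAt (A : Smooth 𝕜 M) (B : Smooth 𝕜 M') (f : M → M') (x : M) : Prop :=
  ∃ U : Set M, A.Open U ∧ x ∈ U ∧ A.MapOn B f U

theorem SmoothAt.tendsto {f : M → M'} {x : M} (h : SmoothAt A B f x) :
    Tendsto f (A.nhds x) (B.nhds (f x)) := by
  let := A.top; let := B.top
  obtain ⟨U, hU, hx, hf⟩ := h
  exact ContinuousOn.continuousAt hf.1 (IsOpen.mem_nhds hU hx)

theorem isOpen_chartDomain {E F X Y : Type*} [TopologicalSpace E] [TopologicalSpace F]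
    [TopologicalSpace X] [TopologicalSpace Y] (e : OpenPartialHomeomorph X E)
    (e' : OpenPartialHomeomorph Y F) {f : X → Y} {U : Set X} (hU : IsOpen U)
    (hf : ContinuousOn f U) : IsOpen (e.target ∩ e.symm ⁻¹' (U ∩ f ⁻¹' e'.source)) :=
  e.isOpen_inter_preimage_symm (hf.isOpen_inter_preimage hU e'.open_source)

theorem MapOn.mono {f : M → M'} {U V : Set M} (hf : A.MapOn B f U) (h : V ⊆ U) :
    A.MapOn B f V :=
  let _ := A.top; let _ := B.top
  ⟨ContinuousOn.mono hf.1 h, fun e he e' he' n => (hf.2 e he e' he' n).mono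
    fun _ hz => ⟨hz.1, h hz.2.1, hz.2.2⟩⟩

theorem mapOn_iff {f : M → M'} {U : Set M} (hU : A.Open U) :
    A.MapOn B f U ↔ ∀ x ∈ U, SmoothAt A B f x := by
  refine ⟨fun h x hx => ⟨U, hU, hx, h⟩, fun h => ?_⟩
  let := A.top; let := B.top; let := A.charted; let := B.charted
  refine ⟨fun x hx => (show ContinuousAt f x from (h x hx).tendsto).continuousWithinAt,
    fun e he e' he' n => IsCn.of_locally fun z hz => ?_⟩
  obtain ⟨V, hV, hxV, hf⟩ := h _ hz.2.1
  exact ⟨_, isOpen_chartDomain e e' hV hf.1, ⟨hz.1, hxV, hz.2.2⟩, hf.2 e he e' he' n⟩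

theorem map_iff {f : M → M'} : A.Map B f ↔ ∀ x, SmoothAt A B f x := by
  rw [Smooth.Map, mapOn_iff A.open_univ]
  simp

theorem SmoothAt.congr {f g : M → M'} {x : M} (hf : SmoothAt A B f x)
    (h : ∀ᶠ y in A.nhds x, f y = g y) : SmoothAt A B g x := by
  obtain ⟨U, hU, hxU, hf⟩ := hf
  obtain ⟨V, hVs, hV, hxV⟩ := mem_nhds_iff.1 h
  let := A.top; let := B.top; let := A.charted; let := B.charted
  have hfV := hf.mono (inter_subset_left (t := V))
  have hfg : EqOn f g (U ∩ V) := fun y hy => hVs hy.2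
  refine ⟨U ∩ V, hU.inter hV, ⟨hxU, hxV⟩, hfV.1.congr hfg.symm, fun e he e' he' n => ?_⟩
  have h1 := (hfV.2 e he e' he' n).congr (isOpen_chartDomain e e' (hU.inter hV) hfV.1)
    (g := fun x => e' (g (e.symm x))) fun z hz => by simp only [hfg hz.2.1]
  refine h1.mono fun z hz => ⟨hz.1, hz.2.1, ?_⟩
  have := hz.2.2
  rwa [mem_preimage, ← hfg hz.2.1] at this

theorem SmoothAt.comp {g : M' → P} {f : M → M'} {x : M} (hg : SmoothAt B C g (f x))
    (hf : SmoothAt A B f x) : SmoothAt A C (fun y => g (f y)) x := by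
  obtain ⟨U, hU, hxU, hf⟩ := hf
  obtain ⟨V, hV, hxV, hg⟩ := hg
  let := A.top; let := B.top; let := C.top
  let := A.charted; let := B.charted; let := C.charted
  have hW : A.Open (U ∩ f ⁻¹' V) := hf.1.isOpen_inter_preimage hU hV
  have hc : ContinuousOn (fun y => g (f y)) (U ∩ f ⁻¹' V) :=
    hg.1.comp (hf.1.mono inter_subset_left) fun y hy => hy.2
  refine ⟨U ∩ f ⁻¹' V, hW, ⟨hxU, hxV⟩, hc, fun e he e' he' n => IsCn.of_locally fun z hz => ?_⟩
  -- Near `z` the coordinate expression factors through a chart `c` at the intermediate point.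
  let c := chartAt B.Model (f (e.symm z))
  have hcm : c ∈ atlas B.Model M' := chart_mem_atlas _ _
  have h1 := hf.2 e he c hcm n
  have h2 := hg.2 c hcm e' he' n
  have o1 := isOpen_chartDomain e c hU hf.1
  have o2 := isOpen_chartDomain c e' hV hg.1
  have o3 := isOpen_chartDomain e e' hW hc
  refine ⟨_ ∩ _, o1.inter o3, ⟨⟨hz.1, hz.2.1.1, mem_chart_source _ _⟩, hz⟩, ?_⟩
  refine IsCn.congr (o1.inter o3) (IsCn.comp (o1.inter o3) o2 h2 (h1.mono inter_subset_left) ?_) ?_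
  · intro y hy
    have hy1 : f (e.symm y) ∈ c.source := hy.1.2.2
    refine ⟨c.map_source hy1, ?_⟩
    rw [mem_preimage, c.left_inv hy1]
    exact ⟨hy.2.2.1.2, hy.2.2.2⟩
  · intro y hy
    have hy1 : f (e.symm y) ∈ c.source := hy.1.2.2
    simp only [c.left_inv hy1]

theorem smoothAt_id (A : Smooth 𝕜 M) (x : M) : SmoothAt A A (fun y => y) x := by
  let := A.top; let := A.charted
  refine ⟨univ, A.open_univ, mem_univ _, continuousOn_id, fun e he e' he' n => ?_⟩
  refine (A.compat e he e' he' n).mono fun z hz => ?_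
  rw [OpenPartialHomeomorph.trans_source]
  exact ⟨hz.1, hz.2.2⟩

theorem smoothAt_const (A : Smooth 𝕜 M) (B : Smooth 𝕜 M') (c : M') (x : M) :
    SmoothAt A B (fun _ => c) x := by
  let := A.top; let := B.top
  exact ⟨univ, A.open_univ, mem_univ _, continuousOn_const, fun e he e' he' n => IsCn.const n _ _⟩

theorem smoothAt_fst (A : Smooth 𝕜 M) (B : Smooth 𝕜 M') (p : M × M') :
    SmoothAt (A.prod B) A (fun q => q.1) p := by
  let := A.top; let := B.top; let := A.charted; let := B.charted
  refine ⟨univ, open_univ _, mem_univ _, continuous_fst.continuousOn, ?_⟩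
  rintro _ ⟨e₁, he₁, e₂, he₂, rfl⟩ e' he' n
  refine ((A.compat e₁ he₁ e' he' n).comp_clm
    (ContinuousLinearMap.fst 𝕜 A.Model B.Model)).mono fun z hz => ?_
  simp only [OpenPartialHomeomorph.trans_source, mem_preimage]
  exact ⟨hz.1.1, hz.2.2⟩

theorem smoothAt_snd (A : Smooth 𝕜 M) (B : Smooth 𝕜 M') (p : M × M') :
    SmoothAt (A.prod B) B (fun q => q.2) p := by
  let := A.top; let := B.top; let := A.charted; let := B.charted
  refine ⟨univ, open_univ _, mem_univ _, continuous_snd.continuousOn, ?_⟩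
  rintro _ ⟨e₁, he₁, e₂, he₂, rfl⟩ e' he' n
  refine ((B.compat e₂ he₂ e' he' n).comp_clm
    (ContinuousLinearMap.snd 𝕜 A.Model B.Model)).mono fun z hz => ?_
  simp only [OpenPartialHomeomorph.trans_source, mem_preimage]
  exact ⟨hz.1.2, hz.2.2⟩

theorem SmoothAt.prodMk {f : P → M} {g : P → M'} {x : P} (hf : SmoothAt C A f x)
    (hg : SmoothAt C B g x) : SmoothAt C (A.prod B) (fun y => (f y, g y)) x := by
  obtain ⟨U, hU, hxU, hf⟩ := hf
  obtain ⟨V, hV, hxV, hg⟩ := hg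
  let := A.top; let := B.top; let := A.charted; let := B.charted
  let := C.top; let := C.charted
  have hf := hf.mono (inter_subset_left (t := V))
  have hg := hg.mono (inter_subset_right (s := U))
  refine ⟨U ∩ V, hU.inter hV, ⟨hxU, hxV⟩, hf.1.prodMk hg.1, ?_⟩
  rintro e he _ ⟨e₁, he₁, e₂, he₂, rfl⟩ n
  exact ((hf.2 e he e₁ he₁ n).mono fun z hz => ⟨hz.1, hz.2.1, hz.2.2.1⟩).prodMk
    ((hg.2 e he e₂ he₂ n).mono fun z hz => ⟨hz.1, hz.2.1, hz.2.2.2⟩)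

theorem SmoothAt.fst {f : P → M × M'} {x : P} (hf : SmoothAt C (A.prod B) f x) :
    SmoothAt C A (fun y => (f y).1) x :=
  (smoothAt_fst A B _).comp hf

theorem SmoothAt.snd {f : P → M × M'} {x : P} (hf : SmoothAt C (A.prod B) f x) :
    SmoothAt C B (fun y => (f y).2) x :=
  (smoothAt_snd A B _).comp hf

theorem Map.smoothAt {f : M → M'} (hf : A.Map B f) (x : M) : SmoothAt A B f x :=
  map_iff.1 hf x

theorem Open.preimage {f : M → M'} (hf : A.Map B f) {U : Set M'} (hU : B.Open U) :
    A.Open (f ⁻¹' U) :=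
  open_iff.2 fun x hx => (hf.smoothAt x).tendsto (hU.mem_nhds hx)

/-! ### Transport of structure -/

/-- The manifold structure obtained from `A` by transport along a bijection. -/
def congr (A : Smooth 𝕜 M) (φ : M ≃ M') : Smooth 𝕜 M' :=
  letI := A.top; letI := A.charted
  letI : TopologicalSpace M' := A.top.induced φ.symm
  let ψ : M' ≃ₜ M := φ.symm.toHomeomorphOfIsInducing ⟨rfl⟩
  { Model := A.Model
    locConvex := A.locConvex
    t2 := @Homeomorph.t2Space M M' _ _ A.t2 ψ.symm
    charted :=
      { atlas := (fun e => ψ.transOpenPartialHomeomorph e) '' atlas A.Model M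
        chartAt := fun x => ψ.transOpenPartialHomeomorph (chartAt A.Model (ψ x))
        mem_chart_source := fun x => mem_chart_source A.Model (ψ x)
        chart_mem_atlas := fun x => ⟨_, chart_mem_atlas A.Model (ψ x), rfl⟩ }
    compat := by
      rintro _ ⟨e, he, rfl⟩ _ ⟨e', he', rfl⟩ n
      have h (y : M) : ψ (ψ.symm y) = y := ψ.apply_symm_apply y
      refine ((A.compat e he e' he' n).mono ?_).congr (OpenPartialHomeomorph.open_source _) ?_
      · intro x hx
        simpa [h] using hx
      · intro x hx
        simp [h] }

theorem congr_smooth (A : Smooth 𝕜 M) (φ : M ≃ M') : A.Map (A.congr φ) φ := by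
  let := A.top; let := A.charted
  let : TopologicalSpace M' := A.top.induced φ.symm
  let ψ : M' ≃ₜ M := φ.symm.toHomeomorphOfIsInducing ⟨rfl⟩
  refine ⟨ψ.symm.continuous.continuousOn, ?_⟩
  rintro e he _ ⟨e', he', rfl⟩ n
  have h (y : M) : ψ (φ y) = y := φ.symm_apply_apply y
  have h' : IsOpen (e.symm.trans e').source := OpenPartialHomeomorph.open_source _
  refine ((A.compat e he e' he' n).congr h' (g := fun x => e' (ψ (φ (e.symm x)))) ?_).mono ?_
  · intro x hx
    simp [h]
  · intro x hx
    have h2 : ψ (φ (e.symm x)) ∈ e'.source := hx.2.2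
    rw [h] at h2
    simpa using ⟨hx.1, h2⟩

theorem congr_symm_smooth (A : Smooth 𝕜 M) (φ : M ≃ M') : (A.congr φ).Map A φ.symm := by
  let := A.top; let := A.charted
  let : TopologicalSpace M' := A.top.induced φ.symm
  let ψ : M' ≃ₜ M := φ.symm.toHomeomorphOfIsInducing ⟨rfl⟩
  refine ⟨ψ.continuous.continuousOn, ?_⟩
  rintro _ ⟨e, he, rfl⟩ e' he' n
  have h (y : M) : φ.symm (ψ.symm y) = y := ψ.apply_symm_apply y
  have h' : IsOpen (e.symm.trans e').source := OpenPartialHomeomorph.open_source _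
  refine ((A.compat e he e' he' n).congr h'
    (g := fun x => e' (φ.symm (ψ.symm (e.symm x)))) ?_).mono ?_
  · intro x hx
    simp [h]
  · intro x hx
    have h2 : φ.symm (ψ.symm (e.symm x)) ∈ e'.source := hx.2.2
    rw [h] at h2
    simpa using ⟨hx.1, h2⟩

theorem congr_diffeo (A : Smooth 𝕜 M) (φ : M ≃ M') : A.Diffeo (A.congr φ) φ :=
  ⟨A.congr_smooth φ, A.congr_symm_smooth φ⟩

end Smooth
/-! ### Lie groups, principal bundles and extensions -/

open Smooth

section

variable {𝕜 : Type v} [RCLike 𝕜] {M G H N E P B : Type u} [Group G] [Group H] [Group N] [Group E]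
  [Group P] {C : Smooth 𝕜 M} {AG : Smooth 𝕜 G} {AH : Smooth 𝕜 H} {AN : Smooth 𝕜 N}
  {AE : Smooth 𝕜 E} {AP : Smooth 𝕜 P} {AB : Smooth 𝕜 B}

theorem IsLieGroup.smoothAt_mul (hG : IsLieGroup AG) {f g : M → G} {x : M}
    (hf : SmoothAt C AG f x) (hg : SmoothAt C AG g x) : SmoothAt C AG (fun y => f y * g y) x :=
  SmoothAt.comp (hG.mul.smoothAt _) (hf.prodMk hg)

theorem IsLieGroup.smoothAt_inv (hG : IsLieGroup AG) {f : M → G} {x : M}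
    (hf : SmoothAt C AG f x) : SmoothAt C AG (fun y => (f y)⁻¹) x :=
  SmoothAt.comp (hG.inv.smoothAt _) hf

theorem IsLieGroup.smoothAt_const_mul (hG : IsLieGroup AG) (g : G) {f : M → G} {x : M}
    (hf : SmoothAt C AG f x) : SmoothAt C AG (fun y => g * f y) x :=
  hG.smoothAt_mul (smoothAt_const _ _ _ _) hf

theorem IsLieGroup.smoothAt_mul_const (hG : IsLieGroup AG) (g : G) {f : M → G} {x : M}
    (hf : SmoothAt C AG f x) : SmoothAt C AG (fun y => f y * g) x :=
  hG.smoothAt_mul hf (smoothAt_const _ _ _ _)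

/-- A homomorphism of Lie groups which is smooth at the identity is smooth. -/
theorem IsLieGroup.map_of_smoothAt_one (hG : IsLieGroup AG) (hH : IsLieGroup AH) {φ : G →* H}
    (h : SmoothAt AG AH φ 1) : AG.Map AH φ := by
  refine map_iff.2 fun x => ?_
  have h1 : SmoothAt AG AH φ (x⁻¹ * x) := by rwa [inv_mul_cancel]
  refine (hH.smoothAt_const_mul (φ x)
    (SmoothAt.comp h1 (hG.smoothAt_const_mul x⁻¹ (smoothAt_id AG x)))).congr
    (Eventually.of_forall fun y => ?_)
  rw [← map_mul, mul_inv_cancel_left]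

theorem IsLieGroup.congr (hN : IsLieGroup AN) (e : N ≃* H) : IsLieGroup (AN.congr e.toEquiv) where
  mul := by
    refine map_iff.2 fun p => ?_
    have h := (AN.congr_symm_smooth e.toEquiv).smoothAt
    refine (SmoothAt.comp ((AN.congr_smooth e.toEquiv).smoothAt _)
      (hN.smoothAt_mul (SmoothAt.comp (h _) (smoothAt_fst _ _ p))
        (SmoothAt.comp (h _) (smoothAt_snd _ _ p)))).congr (Eventually.of_forall fun q => ?_)
    change e (e.symm q.1 * e.symm q.2) = q.1 * q.2
    simp
  inv := by
    refine map_iff.2 fun p => ?_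
    have h := (AN.congr_symm_smooth e.toEquiv).smoothAt
    refine (SmoothAt.comp ((AN.congr_smooth e.toEquiv).smoothAt _)
      (hN.smoothAt_inv (h p))).congr (Eventually.of_forall fun q => ?_)
    change e (e.symm q)⁻¹ = q⁻¹
    simp

/-- A map `i` is initial if a map `f` into its domain is smooth as soon as `i ∘ f` is. -/
def IsInitial (AB : Smooth 𝕜 B) (C : Smooth 𝕜 M) (i : B → M) : Prop :=
  ∀ (X : Type u) (A : Smooth 𝕜 X) (f : X → B) (x : X),
    SmoothAt A C (fun y => i (f y)) x → SmoothAt A AB f x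

theorem IsInitial.comp {Y : Type u} {D : Smooth 𝕜 Y} {i : B → M} {j : M → Y}
    (hj : IsInitial C D j) (hi : IsInitial AB C i) : IsInitial AB D (fun x => j (i x)) :=
  fun X A f x h => hi X A f x (hj X A _ x h)

theorem IsInitial.of_leftInverse {i : B → M} {r : M → B} (hr : C.Map AB r)
    (h : Function.LeftInverse r i) : IsInitial AB C i := fun _ _ f _ hf =>
  (SmoothAt.comp (hr.smoothAt _) hf).congr (Eventually.of_forall fun y => h (f y))

/-- The structure group of a principal bundle is initial in the total space. -/
theorem IsPrincipalBundle.isInitial {i : H →* P} {π : P → B}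
    (h : IsPrincipalBundle AH AP AB i π) (hH : IsLieGroup AH) : IsInitial AH AP i := by
  intro X A f x hf
  obtain ⟨U, hU, hxU, σ, -, -, τ, hτ, hστ⟩ := h.locally_trivial (π (i (f x)))
  have hπ (y : X) : π (i (f x)) = π (i (f y)) :=
    (h.fibre _ _).2 ⟨(f x)⁻¹ * f y, by rw [map_mul, map_inv, mul_inv_cancel_left]⟩
  have hτ' := (mapOn_iff (Open.preimage h.smooth_proj hU)).1 hτ (i (f x)) hxU
  -- All points `i (f y)` lie over one base point `b`, so `i (f y) = σ b * i (τ (i (f y)))` with `σ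
  -- b` fixed. Comparison with `y = x` eliminates `σ b` and expresses `f` through the smooth map
  -- `τ`.
  refine (hH.smoothAt_const_mul (f x * (τ (i (f x)))⁻¹)
    (SmoothAt.comp (f := fun y => i (f y)) hτ' hf)).congr
    (Eventually.of_forall fun y => h.injective ?_)
  have h1 := hστ (i (f x)) hxU
  have h2 := hστ (i (f y)) (by rw [mem_preimage, ← hπ y]; exact hxU)
  rw [← hπ y] at h2
  rw [map_mul, map_mul, map_inv, ← eq_mul_inv_of_mul_eq h1, h2]

/-- A short exact sequence of Lie groups with initial kernel and a section which is smooth at the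
identity is an extension of Lie groups. -/
theorem IsLieExtension.of_section (hN : IsLieGroup AN) (hE : IsLieGroup AE) (hG : IsLieGroup AG)
    {ι : N →* E} {q : E →* G} (hex : ι.range = q.ker) (hinj : Function.Injective ι)
    (hι : AN.Map AE ι) (hq : AE.Map AG q) (hin : IsInitial AN AE ι) {σ : G → E}
    (hσ : SmoothAt AG AE σ 1) (hqσ : ∀ g, q (σ g) = g) : IsLieExtension AN AE AG ι q where
  lie_left := hN
  lie_mid := hE
  lie_right := hG
  exact := hex
  bundle :=
    { injective := hinj
      smooth_incl := hι
      smooth_proj := hq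
      surjective := fun g => ⟨σ g, hqσ g⟩
      fibre := fun x y => by
        have h : (∃ n, y = x * ι n) ↔ x⁻¹ * y ∈ ι.range := by
          exact exists_congr fun n => by rw [eq_inv_mul_iff_mul_eq, eq_comm]
        rw [h, hex, MonoidHom.mem_ker, map_mul, map_inv, inv_mul_eq_one]
      locally_trivial := fun b => by
        obtain ⟨U, hU, h1U, hσ⟩ := hσ
        have hb : AG.Map AG (fun x => b⁻¹ * x) :=
          map_iff.2 fun x => hG.smoothAt_const_mul _ (smoothAt_id _ _)
        have hV : AG.Open ((fun x => b⁻¹ * x) ⁻¹' U) := Open.preimage hb hU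
        -- The section near `b` is the translate `x ↦ σ b * σ (b⁻¹ * x)` of the one near `1`.
        have hs : ∀ x ∈ (fun x => b⁻¹ * x) ⁻¹' U,
            SmoothAt AG AE (fun x => σ b * σ (b⁻¹ * x)) x := fun x hx =>
          hE.smoothAt_const_mul _ (SmoothAt.comp ((mapOn_iff hU).1 hσ _ hx) (hb.smoothAt x))
        have hqs (x : G) : q (σ b * σ (b⁻¹ * x)) = x := by
          rw [map_mul, hqσ, hqσ, mul_inv_cancel_left]
        have hex' (y : E) : ∃ n, ι n = (σ b * σ (b⁻¹ * q y))⁻¹ * y := by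
          have : (σ b * σ (b⁻¹ * q y))⁻¹ * y ∈ ι.range := by
            rw [hex, MonoidHom.mem_ker, map_mul, map_inv, hqs, inv_mul_cancel]
          exact this
        -- Only `ι ∘ τ` has an explicit smooth formula; initiality of `ι` transfers its smoothness
        -- to `τ`.
        choose τ hτ using hex'
        refine ⟨_, hV, by simpa using h1U, _, (mapOn_iff hV).2 hs, fun x _ => hqs x, τ,
          (mapOn_iff (Open.preimage hq hV)).2 fun y hy => hin _ _ _ _ ?_, fun y _ => ?_⟩
        · simp only [hτ]
          exact hE.smoothAt_mul
            (hE.smoothAt_inv (SmoothAt.comp (f := q) (hs _ hy) (hq.smoothAt y))) (smoothAt_id _ _)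
        · rw [hτ, mul_inv_cancel_left] }

namespace IsLieExtension

variable {ι : N →* E} {q : E →* G}

theorem isInitial (h : IsLieExtension AN AE AG ι q) : IsInitial AN AE ι :=
  h.bundle.isInitial h.lie_left

theorem q_ι (h : IsLieExtension AN AE AG ι q) (n : N) : q (ι n) = 1 := by
  rw [← MonoidHom.mem_ker, ← h.exact]
  exact ⟨n, rfl⟩

theorem exists_ι_eq (h : IsLieExtension AN AE AG ι q) {x : E} (hx : q x = 1) : ∃ n, ι n = x := by
  rw [← MonoidHom.mem_ker, ← h.exact] at hx
  exact hx

/-- A local section is normalized by right multiplication with `(σ 1)⁻¹`, which lies over `1`, and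
continued by arbitrary preimages outside `U`. -/
theorem exists_section (h : IsLieExtension AN AE AG ι q) :
    ∃ σ : G → E, IsC1s AG AE σ ∧ ∀ g, q (σ g) = g := by
  classical
  obtain ⟨U, hU, h1U, σ, hσ, hqσ, -⟩ := h.bundle.locally_trivial 1
  obtain ⟨s, hs⟩ := h.bundle.surjective.hasRightInverse
  refine ⟨fun g => if g ∈ U then σ g * (σ 1)⁻¹ else s g, ⟨by simp [h1U], ?_⟩, fun g => ?_⟩
  · refine SmoothAt.congr (f := fun g => σ g * (σ 1)⁻¹)
      (h.lie_mid.smoothAt_mul_const _ ((mapOn_iff hU).1 hσ 1 h1U)) ?_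
    filter_upwards [hU.mem_nhds h1U] with g hg
    simp [hg]
  · by_cases hg : g ∈ U
    · simp [hg, hqσ g hg, hqσ 1 h1U]
    · simp [hg, hs g]

/-- Equivalences of extensions are isomorphisms of Lie groups. -/
theorem exists_mulEquiv {E₁ E₂ : Type u} [Group E₁] [Group E₂] {A₁ : Smooth 𝕜 E₁}
    {A₂ : Smooth 𝕜 E₂} {ι₁ : N →* E₁} {q₁ : E₁ →* G} {ι₂ : N →* E₂} {q₂ : E₂ →* G}
    (h₁ : IsLieExtension AN A₁ AG ι₁ q₁) (h₂ : IsLieExtension AN A₂ AG ι₂ q₂) {φ : E₁ →* E₂}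
    (hφ : IsExtEquiv A₁ A₂ ι₁ q₁ ι₂ q₂ φ) :
    ∃ e : E₁ ≃* E₂, e.toMonoidHom = φ ∧ A₂.Map A₁ e.symm ∧
      IsExtEquiv A₂ A₁ ι₂ q₂ ι₁ q₁ e.symm.toMonoidHom := by
  have hι (n : N) : φ (ι₁ n) = ι₂ n := DFunLike.congr_fun hφ.comp_left n
  have hq (x : E₁) : q₂ (φ x) = q₁ x := DFunLike.congr_fun hφ.comp_right x
  obtain ⟨σ, ⟨-, hσ⟩, hqσ⟩ := h₁.exists_section
  -- The elements `y` and `φ (σ (q₂ y))` have the same image in `G`, hence differ by some `ι₂ (τ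
  -- y)`. The resulting formula `σ (q₂ y) * ι₁ (τ y)` for the preimage of `y` gives both
  -- surjectivity and smoothness of the inverse at `1`.
  have hex (y : E₂) : ∃ n, ι₂ n = (φ (σ (q₂ y)))⁻¹ * y :=
    h₂.exists_ι_eq (by rw [map_mul, map_inv, hq, hqσ, inv_mul_cancel])
  choose τ hτ using hex
  have key (y : E₂) : φ (σ (q₂ y) * ι₁ (τ y)) = y := by
    rw [map_mul, hι, hτ, mul_inv_cancel_left]
  have hbij : Function.Bijective φ := by
    refine ⟨(injective_iff_map_eq_one φ).2 fun x hx => ?_, fun y => ⟨_, key y⟩⟩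
    obtain ⟨n, rfl⟩ := h₁.exists_ι_eq (x := x) (by rw [← hq, hx, map_one])
    rw [hι, ← map_one ι₂] at hx
    rw [h₂.bundle.injective hx, map_one]
  let e : E₁ ≃* E₂ := MulEquiv.ofBijective φ hbij
  have he (x : E₁) : e x = φ x := rfl
  have hes (y : E₂) : e.symm y = σ (q₂ y) * ι₁ (τ y) := by
    rw [MulEquiv.symm_apply_eq, he, key]
  have hs : SmoothAt A₂ A₁ e.symm 1 := by
    have hσ' : SmoothAt A₂ A₁ (fun y => σ (q₂ y)) 1 := by
      refine SmoothAt.comp ?_ (h₂.bundle.smooth_proj.smoothAt 1)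
      rw [map_one]
      exact hσ
    have hτ' : SmoothAt A₂ AN τ 1 := by
      refine h₂.isInitial _ _ _ _ ?_
      simp only [hτ]
      exact h₂.lie_mid.smoothAt_mul (h₂.lie_mid.smoothAt_inv
        (SmoothAt.comp (hφ.smooth.smoothAt _) hσ')) (smoothAt_id _ _)
    exact (h₁.lie_mid.smoothAt_mul hσ'
      (SmoothAt.comp (h₁.bundle.smooth_incl.smoothAt _) hτ')).congr
      (Eventually.of_forall fun y => (hes y).symm)
  have hsm : A₂.Map A₁ e.symm :=
    h₂.lie_mid.map_of_smoothAt_one h₁.lie_mid (φ := e.symm.toMonoidHom) hs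
  refine ⟨e, rfl, hsm, hsm, MonoidHom.ext fun n => ?_, MonoidHom.ext fun y => ?_⟩
  · change e.symm (ι₂ n) = ι₁ n
    rw [MulEquiv.symm_apply_eq, he, hι]
  · change q₁ (e.symm y) = q₂ y
    rw [← hq, ← he, MulEquiv.apply_symm_apply]

/-- The kernel of an extension is a split Lie subgroup. -/
theorem isSplitLieSubgroup (h : IsLieExtension AN AE AG ι q) {K : Subgroup E} [K.Normal]
    (eN : N ≃* K) (heN : ∀ n, (eN n : E) = ι n) (eQ : E ⧸ K ≃* G)
    (heQ : ∀ x : E, eQ x = q x) :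
    IsSplitLieSubgroup AE K (AN.congr eN.toEquiv) (AG.congr eQ.symm.toEquiv) where
  lie := h.lie_left.congr eN
  bundle := by
    have heN' (k : K) : ι (eN.symm k) = k := by rw [← heN, MulEquiv.apply_symm_apply]
    have heQ' (x : E) : eQ.symm (q x) = x := by rw [← heQ, MulEquiv.symm_apply_apply]
    refine
      { injective := K.subtype_injective
        smooth_incl := map_iff.2 fun k => ?_
        smooth_proj := map_iff.2 fun x => ?_
        surjective := QuotientGroup.mk_surjective
        fibre := fun x y => ?_
        locally_trivial := fun b => ?_ }
    · exact (SmoothAt.comp (h.bundle.smooth_incl.smoothAt _)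
        ((AN.congr_symm_smooth eN.toEquiv).smoothAt k)).congr (Eventually.of_forall heN')
    · exact (SmoothAt.comp ((AG.congr_smooth eQ.symm.toEquiv).smoothAt _)
        (h.bundle.smooth_proj.smoothAt x)).congr (Eventually.of_forall heQ')
    · rw [QuotientGroup.eq]
      exact ⟨fun hk => ⟨⟨_, hk⟩, (mul_inv_cancel_left _ _).symm⟩, fun ⟨k, hk⟩ => by
        rw [hk, inv_mul_cancel_left]; exact k.2⟩
    · have hQ : (AG.congr eQ.symm.toEquiv).Map AG eQ := AG.congr_symm_smooth eQ.symm.toEquiv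
      obtain ⟨U, hU, hbU, σ, hσ, hqσ, τ, hτ, hστ⟩ := h.bundle.locally_trivial (eQ b)
      have hpre : (fun x : E => (x : E ⧸ K)) ⁻¹' (eQ ⁻¹' U) = q ⁻¹' U := by
        ext x
        simp [heQ]
      have hqU : AE.Open (q ⁻¹' U) := Open.preimage h.bundle.smooth_proj hU
      refine ⟨eQ ⁻¹' U, Open.preimage hQ hU, hbU, fun x => σ (eQ x),
        (mapOn_iff (Open.preimage hQ hU)).2 fun x hx =>
          SmoothAt.comp ((mapOn_iff hU).1 hσ _ hx) (hQ.smoothAt x),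
        fun x hx => ?_, fun y => eN (τ y), ?_, ?_⟩
      · rw [← heQ', hqσ _ hx, MulEquiv.symm_apply_apply]
      · rw [hpre]
        exact (mapOn_iff hqU).2 fun y hy =>
          SmoothAt.comp ((AN.congr_smooth eN.toEquiv).smoothAt _) ((mapOn_iff hqU).1 hτ y hy)
      · rw [hpre]
        intro y hy
        change σ (eQ y) * (eN (τ y) : E) = y
        rw [heN, heQ]
        exact hστ y hy

theorem exists_quotientEquiv (h : IsLieExtension AN AE AG ι q) {K : Subgroup E} [K.Normal]
    (hK : K = ι.range) : ∃ eQ : E ⧸ K ≃* G, ∀ x : E, eQ x = q x :=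
  ⟨(QuotientGroup.quotientMulEquivOfEq (hK.trans h.exact)).trans
    (QuotientGroup.quotientKerEquivOfSurjective q h.bundle.surjective), fun _ => rfl⟩

theorem exists_kernelEquiv (h : IsLieExtension AN AE AG ι q) {K : Subgroup E}
    (hK : K = ι.range) : ∃ eN : N ≃* K, ∀ n, (eN n : E) = ι n :=
  ⟨(MonoidHom.ofInjective h.bundle.injective).trans (MulEquiv.subgroupCongr hK.symm),
    fun _ => rfl⟩

end IsLieExtension

end
/-! ### Lie group structures from local data -/

open Smooth

namespace LocalLieGroup

variable {𝕜 : Type v} [RCLike 𝕜] {K : Type u} {A : Smooth 𝕜 K}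

/-- The charts of a manifold. -/
def charts (A : Smooth 𝕜 K) : Set (@OpenPartialHomeomorph K A.Model A.top _) :=
  letI := A.top
  letI := A.charted
  atlas A.Model K

/-- The bijection underlying a chart. -/
def chartEquiv (e : @OpenPartialHomeomorph K A.Model A.top _) : PartialEquiv K A.Model :=
  letI := A.top
  e.toPartialEquiv

theorem open_chartEquiv (e : @OpenPartialHomeomorph K A.Model A.top _) {O : Set A.Model}
    (hO : IsOpen O) : A.Open ((chartEquiv e).source ∩ chartEquiv e ⁻¹' O) :=
  let _ := A.top
  e.isOpen_inter_preimage hO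

theorem isOpen_chartEquiv_symm (e : @OpenPartialHomeomorph K A.Model A.top _) {O : Set K}
    (hO : A.Open O) : IsOpen ((chartEquiv e).target ∩ (chartEquiv e).symm ⁻¹' O) :=
  let _ := A.top
  e.isOpen_inter_preimage_symm hO

end LocalLieGroup

/-- Conjugations fix `1`, so smoothness there passes to products. For `G^S` this allows checking the
factors `(C_N(m), 1)` and `(1, g)` separately. -/
theorem smoothAt_conj_mul {𝕜 : Type v} [RCLike 𝕜] {K : Type u} [Group K] {A : Smooth 𝕜 K}
    {k l : K} (hk : SmoothAt A A (fun x => k * x * k⁻¹) 1)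
    (hl : SmoothAt A A (fun x => l * x * l⁻¹) 1) :
    SmoothAt A A (fun x => k * l * x * (k * l)⁻¹) 1 := by
  have h1 : l * 1 * l⁻¹ = 1 := by simp
  rw [← h1] at hk
  refine (SmoothAt.comp (f := fun x => l * x * l⁻¹) hk hl).congr (Eventually.of_forall fun y => ?_)
  simp only [mul_inv_rev, mul_assoc]

/-- A manifold structure `A` on a group `K` is compatible with the group structure near the
identity: left translations between points of the open identity neighbourhood `V` are smooth on
`V`, and multiplication, inversion and all conjugations are smooth at the identity. -/
structure LocalLieGroup {𝕜 : Type v} [RCLike 𝕜] {K : Type u} [Group K] (A : Smooth 𝕜 K)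
    (V : Set K) : Prop where
  isOpen : A.Open V
  one_mem : 1 ∈ V
  left : ∀ k, ∀ x ∈ V, k * x ∈ V → SmoothAt A A (fun y => k * y) x
  mul : SmoothAt (A.prod A) A (fun p => p.1 * p.2) (1, 1)
  inv : SmoothAt A A (fun x => x⁻¹) 1
  conj : ∀ k, SmoothAt A A (fun x => k * x * k⁻¹) 1

namespace LocalLieGroup

variable {𝕜 : Type v} [RCLike 𝕜] {K : Type u} [Group K] {A : Smooth 𝕜 K} {V : Set K}

/-- The left invariant topology which agrees with the given one on `V`. -/
abbrev topology (h : LocalLieGroup A V) : TopologicalSpace K :=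
  letI := A.top
  { IsOpen := fun s => ∀ k, A.Open (V ∩ (fun x => k * x) ⁻¹' s)
    isOpen_univ := fun k => by simpa using h.isOpen
    isOpen_inter := fun s t hs ht k => by
      have := IsOpen.inter (hs k) (ht k)
      rwa [← inter_inter_distrib_left, ← preimage_inter] at this
    isOpen_sUnion := fun S hS k => by
      rw [preimage_sUnion, inter_iUnion₂]
      exact isOpen_biUnion fun s hs => hS s hs k }

variable (h : LocalLieGroup A V)

/-- On `V` the left invariant topology is not coarser than the original one: wherever a translation
carries a point of `V` into `s ⊆ V`, it is continuous there by the field `left`. -/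
theorem isOpen_of_subset {s : Set K} (hs : A.Open s) (hsV : s ⊆ V) : IsOpen[h.topology] s := by
  intro k
  refine open_iff.2 fun x hx => inter_mem (h.isOpen.mem_nhds hx.1) ?_
  exact (h.left k x hx.1 (hsV hx.2)).tendsto (hs.mem_nhds hx.2)

theorem open_inter {s : Set K} (hs : IsOpen[h.topology] s) : A.Open (V ∩ s) := by
  have := hs 1
  simpa using this

theorem isOpen_translate {s : Set K} (hs : IsOpen[h.topology] s) (k : K) :
    IsOpen[h.topology] ((fun x => k * x) ⁻¹' s) := by
  intro k'
  have := hs (k * k')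
  simpa [preimage_preimage, mul_assoc] using this

theorem mapOn_left (h : LocalLieGroup A V) (k : K) :
    A.MapOn A (fun y => k * y) (V ∩ (fun x => k * x) ⁻¹' V) :=
  (mapOn_iff (h.isOpen_of_subset h.isOpen subset_rfl k)).2 fun x hx => h.left k x hx.1 hx.2

/-- Left translations are homeomorphisms. -/
def translation (k : K) : @Homeomorph K K h.topology h.topology :=
  letI := h.topology
  { Equiv.mulLeft k with
    continuous_toFun := ⟨fun _ hs => h.isOpen_translate hs k⟩
    continuous_invFun := ⟨fun _ hs => h.isOpen_translate hs k⁻¹⟩ }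

theorem isOpen_restr_preimage (e : @OpenPartialHomeomorph K A.Model A.top _) {O : Set A.Model}
    (hO : IsOpen O) : IsOpen[h.topology]
      (((chartEquiv e).restr V).source ∩ ((chartEquiv e).restr V) ⁻¹' O) := by
  have h1 : ((chartEquiv e).restr V).source ∩ ((chartEquiv e).restr V) ⁻¹' O =
      (chartEquiv e).source ∩ chartEquiv e ⁻¹' O ∩ V := by
    ext x
    simp
    tauto
  rw [h1]
  exact h.isOpen_of_subset ((open_chartEquiv e hO).inter h.isOpen) inter_subset_right

theorem isOpen_restr_symm_preimage (e : @OpenPartialHomeomorph K A.Model A.top _) {O : Set K}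
    (hO : IsOpen[h.topology] O) :
    IsOpen (((chartEquiv e).restr V).target ∩ ((chartEquiv e).restr V).symm ⁻¹' O) := by
  have h1 : ((chartEquiv e).restr V).target ∩ ((chartEquiv e).restr V).symm ⁻¹' O =
      (chartEquiv e).target ∩ (chartEquiv e).symm ⁻¹' (V ∩ O) := by
    ext x
    simp
    tauto
  rw [h1]
  exact isOpen_chartEquiv_symm e (h.open_inter hO)

/-- The restriction of a chart to `V`, as a chart for the left invariant topology. -/
def baseChart (e : @OpenPartialHomeomorph K A.Model A.top _) :
    @OpenPartialHomeomorph K A.Model h.topology _ :=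
  letI := h.topology
  have hs : IsOpen ((chartEquiv e).restr V).source := by
    simpa using h.isOpen_restr_preimage e isOpen_univ
  have ht : IsOpen ((chartEquiv e).restr V).target := by
    simpa using h.isOpen_restr_symm_preimage e (@isOpen_univ K h.topology)
  { toPartialEquiv := (chartEquiv e).restr V
    open_source := hs
    open_target := ht
    continuousOn_toFun := (continuousOn_open_iff hs).2 fun _ hO => h.isOpen_restr_preimage e hO
    continuousOn_invFun :=
      (continuousOn_open_iff ht).2 fun _ hO => h.isOpen_restr_symm_preimage e hO }

/-- The translate of a chart by `k`. -/
def chart (k : K) (e : @OpenPartialHomeomorph K A.Model A.top _) :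
    @OpenPartialHomeomorph K A.Model h.topology _ :=
  letI := h.topology
  (h.translation k⁻¹).transOpenPartialHomeomorph (h.baseChart e)

/-- Coordinate changes between translated charts, left translations, and the comparison with `A` on
`V` all have this form in coordinates. -/
theorem isCn_left (h : LocalLieGroup A V) (k : K) {e e' : @OpenPartialHomeomorph K A.Model A.top _}
    (he : e ∈ charts A) (he' : e' ∈ charts A) (n : ℕ) :
    IsCn 𝕜 n (fun x => chartEquiv e' (k * (chartEquiv e).symm x))
      {x | x ∈ (chartEquiv e).target ∧ (chartEquiv e).symm x ∈ V ∧
        k * (chartEquiv e).symm x ∈ V ∧ k * (chartEquiv e).symm x ∈ (chartEquiv e').source} :=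
  let _ := A.top
  let _ := A.charted
  ((h.mapOn_left k).2 e he e' he' n).mono fun _ hx => ⟨hx.1, ⟨hx.2.1, hx.2.2.1⟩, hx.2.2.2⟩

/-- If `k ∈ V`, the Hausdorff topology of `A` separates `1` from `k`. If `k ∉ V`, shrink so that all
quotients `u * w⁻¹` lie in `V`; then none of them equals `k`. -/
theorem exists_separated (h : LocalLieGroup A V) {k : K} (hk : k ≠ 1) :
    ∃ O O' : Set K, IsOpen[h.topology] O ∧ IsOpen[h.topology] O' ∧ 1 ∈ O ∧ 1 ∈ O' ∧
      ∀ u ∈ O, ∀ w ∈ O', u ≠ k * w := by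
  by_cases hkV : k ∈ V
  · let := A.top
    have := A.t2
    obtain ⟨O, O', hO, hO', h1O, hkO', hd⟩ := t2_separation hk.symm
    refine ⟨V ∩ O, _, h.isOpen_of_subset (h.isOpen.inter hO) inter_subset_left,
      h.isOpen_translate (h.isOpen_of_subset (h.isOpen.inter hO') inter_subset_left) k,
      ⟨h.one_mem, h1O⟩, by simpa using ⟨hkV, hkO'⟩, ?_⟩
    rintro u hu w hw rfl
    exact disjoint_left.1 hd hu.2 hw.2
  · have hm : SmoothAt (A.prod A) A (fun p => p.1 * p.2⁻¹) (1, 1) := by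
      refine SmoothAt.comp (g := fun p : K × K => p.1 * p.2) (f := fun p : K × K => (p.1, p.2⁻¹))
        ?_ ((smoothAt_fst _ _ _).prodMk (SmoothAt.comp h.inv (smoothAt_snd _ _ (1, 1))))
      simpa using h.mul
    have hV : V ∈ A.nhds ((1 : K) * 1⁻¹) := by simpa using h.isOpen.mem_nhds h.one_mem
    have hp := hm.tendsto hV
    rw [nhds_prod, mem_map, mem_prod_iff] at hp
    obtain ⟨O, hO, O', hO', hOO'⟩ := hp
    obtain ⟨W, hWO, hW, h1W⟩ := Smooth.mem_nhds_iff.1 hO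
    obtain ⟨W', hWO', hW', h1W'⟩ := Smooth.mem_nhds_iff.1 hO'
    refine ⟨V ∩ W, V ∩ W', h.isOpen_of_subset (h.isOpen.inter hW) inter_subset_left,
      h.isOpen_of_subset (h.isOpen.inter hW') inter_subset_left,
      ⟨h.one_mem, h1W⟩, ⟨h.one_mem, h1W'⟩, ?_⟩
    rintro u hu w hw rfl
    have : (k * w, w) ∈ O ×ˢ O' := ⟨hWO hu.2, hWO' hw.2⟩
    have := hOO' this
    simp at this
    exact hkV this

theorem t2Space (h : LocalLieGroup A V) : @T2Space K h.topology := by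
  let := h.topology
  refine ⟨fun x y hxy => ?_⟩
  obtain ⟨O, O', hO, hO', h1, h1', hd⟩ :=
    h.exists_separated (k := x⁻¹ * y) (by rwa [Ne, inv_mul_eq_one])
  refine ⟨_, _, h.isOpen_translate hO x⁻¹, h.isOpen_translate hO' y⁻¹, by simpa using h1,
    by simpa using h1', disjoint_left.2 fun z hz hz' => hd _ hz _ hz' ?_⟩
  simp [mul_assoc]

/-- The left invariant manifold structure which agrees with the given one on `V`. -/
def smooth (h : LocalLieGroup A V) : Smooth 𝕜 K where
  Model := A.Model
  locConvex := A.locConvex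
  top := h.topology
  t2 := h.t2Space
  charted :=
    letI := h.topology
    { atlas := {c | ∃ k, ∃ e ∈ charts A, c = h.chart k e}
      chartAt := fun x => h.chart x (letI := A.top; letI := A.charted; chartAt A.Model 1)
      mem_chart_source := fun x => by
        let := A.top
        let := A.charted
        have h1 : (1 : K) ∈ (chartAt A.Model (1 : K)).source := mem_chart_source _ _
        change x⁻¹ * x ∈ (chartAt A.Model (1 : K)).source ∩ V
        rw [inv_mul_cancel]
        exact ⟨h1, h.one_mem⟩
      chart_mem_atlas := fun x => by
        let := A.top
        let := A.charted
        exact ⟨x, _, chart_mem_atlas A.Model (1 : K), rfl⟩ }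
  compat := by
    rintro _ ⟨k, e, he, rfl⟩ _ ⟨k', e', he', rfl⟩ n
    -- `chart k e` begins with translation by `k⁻¹`, whose inverse is definitionally translation by
    -- `k⁻¹⁻¹`.
    have h1 := h.isCn_left (k'⁻¹ * k⁻¹⁻¹) he he' n
    simp only [mul_assoc] at h1
    exact h1.mono fun x hx => ⟨hx.1.1, hx.1.2, hx.2.2, hx.2.1⟩

theorem smooth_left (h : LocalLieGroup A V) (k : K) : h.smooth.Map h.smooth (fun x => k * x) := by
  let := h.topology
  refine ⟨(h.translation k).continuous.continuousOn, ?_⟩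
  rintro _ ⟨k₁, e, he, rfl⟩ _ ⟨k', e', he', rfl⟩ n
  have h1 := h.isCn_left (k'⁻¹ * (k * k₁⁻¹⁻¹)) he he' n
  simp only [mul_assoc] at h1
  exact h1.mono fun x hx => ⟨hx.1.1, hx.1.2, hx.2.2.2, hx.2.2.1⟩

theorem smoothAt_to (h : LocalLieGroup A V) {x : K} (hx : x ∈ V) :
    SmoothAt A h.smooth (fun y => y) x := by
  refine ⟨V, h.isOpen, hx, (@continuousOn_open_iff _ _ A.top h.topology _ _ h.isOpen).2
    fun s hs => h.open_inter hs, ?_⟩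
  rintro e he _ ⟨k', e', he', rfl⟩ n
  exact (h.isCn_left k'⁻¹ he he' n).mono fun x hx => ⟨hx.1, hx.2.1, hx.2.2.2, hx.2.2.1⟩

theorem smoothAt_from (h : LocalLieGroup A V) {x : K} (hx : x ∈ V) :
    SmoothAt h.smooth A (fun y => y) x := by
  have hV : h.smooth.Open V := h.isOpen_of_subset h.isOpen subset_rfl
  refine ⟨V, hV, hx, (@continuousOn_open_iff _ _ h.topology A.top _ _ hV).2
    fun s hs => h.isOpen_of_subset (h.isOpen.inter hs) inter_subset_left, ?_⟩
  rintro _ ⟨k, e, he, rfl⟩ e' he' n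
  exact (h.isCn_left k⁻¹⁻¹ he he' n).mono fun x hx => ⟨hx.1.1, hx.1.2, hx.2.1, hx.2.2⟩

theorem smoothAt_of_one (h : LocalLieGroup A V) {f : K → K} (hf : SmoothAt A A f 1)
    (h1 : f 1 = 1) : SmoothAt h.smooth h.smooth f 1 :=
  SmoothAt.comp (f := f) (g := fun x => x) (h.smoothAt_to (h1.symm ▸ h.one_mem))
    (SmoothAt.comp (f := fun x => x) hf (h.smoothAt_from h.one_mem))

/-- Left translations are smooth everywhere, so the identities `x y = a b · (b⁻¹ (a⁻¹ x) b) · (b⁻¹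
y)` and `x⁻¹ = a⁻¹ · a (a⁻¹ x)⁻¹ a⁻¹` reduce everything to multiplication, inversion and
conjugations at `1`. -/
theorem isLieGroup (h : LocalLieGroup A V) : IsLieGroup h.smooth where
  mul := by
    refine map_iff.2 fun ⟨a, b⟩ => ?_
    have hl (k : K) {M : Type u} {C : Smooth 𝕜 M} {f : M → K} {x : M}
        (hf : SmoothAt C h.smooth f x) : SmoothAt C h.smooth (fun y => k * f y) x :=
      SmoothAt.comp ((h.smooth_left k).smoothAt _) hf
    have hm : SmoothAt (h.smooth.prod h.smooth) h.smooth (fun p => p.1 * p.2) (1, 1) := by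
      refine SmoothAt.comp (f := fun p : K × K => p.1 * p.2) (g := fun x => x)
        (by simpa using h.smoothAt_to h.one_mem) ?_
      refine SmoothAt.comp (f := fun p : K × K => (p.1, p.2)) (g := fun p : K × K => p.1 * p.2)
        h.mul (SmoothAt.prodMk ?_ ?_)
      · exact SmoothAt.comp (g := fun x => x) (h.smoothAt_from h.one_mem) (smoothAt_fst _ _ (1, 1))
      · exact SmoothAt.comp (g := fun x => x) (h.smoothAt_from h.one_mem) (smoothAt_snd _ _ (1, 1))
    have hc : SmoothAt h.smooth h.smooth (fun x => b⁻¹ * x * b) 1 := by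
      have := h.smoothAt_of_one (h.conj b⁻¹) (by simp)
      simpa using this
    have hc' : SmoothAt (h.smooth.prod h.smooth) h.smooth
        (fun p => b⁻¹ * (a⁻¹ * p.1) * b) (a, b) :=
      SmoothAt.comp (f := fun p : K × K => a⁻¹ * p.1) (g := fun x => b⁻¹ * x * b)
        (by simpa using hc) (hl _ (smoothAt_fst _ _ _))
    refine (hl (a * b) (SmoothAt.comp (g := fun p : K × K => p.1 * p.2)
      (f := fun p : K × K => (b⁻¹ * (a⁻¹ * p.1) * b, b⁻¹ * p.2)) (by simpa using hm)
      (hc'.prodMk (hl _ (smoothAt_snd _ _ _))))).congr (Eventually.of_forall fun p => ?_)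
    simp [mul_assoc]
  inv := by
    refine map_iff.2 fun a => ?_
    have hl (k : K) {f : K → K} {x : K} (hf : SmoothAt h.smooth h.smooth f x) :
        SmoothAt h.smooth h.smooth (fun y => k * f y) x :=
      SmoothAt.comp ((h.smooth_left k).smoothAt _) hf
    have hi := h.smoothAt_of_one h.inv inv_one
    have hi' : SmoothAt h.smooth h.smooth (fun x => (a⁻¹ * x)⁻¹) a :=
      SmoothAt.comp (f := fun x => a⁻¹ * x) (g := fun x => x⁻¹)
        (by simpa using hi) (hl _ (smoothAt_id _ _))
    have hc := h.smoothAt_of_one (h.conj a) (by simp)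
    refine (hl a⁻¹ (SmoothAt.comp (f := fun x => (a⁻¹ * x)⁻¹) (g := fun x => a * x * a⁻¹)
      (by simpa using hc) hi')).congr (Eventually.of_forall fun p => ?_)
    simp [mul_assoc]

end LocalLieGroup
/-! ### The natural Lie group structure on `G^S` -/

open Smooth

section

variable {𝕜 : Type v} [RCLike 𝕜] {G N H P B M : Type u} [Group G] [Group N] [Group H] [Group P]
  {AG : Smooth 𝕜 G} {AN : Smooth 𝕜 N} {AZ : Smooth 𝕜 (Subgroup.center N)}
  {Aad : Smooth 𝕜 (Nad N)} {C : Smooth 𝕜 M} {AH : Smooth 𝕜 H} {AP : Smooth 𝕜 P}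
  {AB : Smooth 𝕜 B}

/-- Choosing a section defined everywhere but smooth only at `b` avoids tracking domains in the
formulas that follow. -/
theorem IsPrincipalBundle.exists_section {i : H →* P} {π : P → B}
    (h : IsPrincipalBundle AH AP AB i π) (b : B) :
    ∃ σ : B → P, SmoothAt AB AP σ b ∧ ∀ x, π (σ x) = x := by
  classical
  obtain ⟨U, hU, hbU, σ, hσ, hπσ, -⟩ := h.locally_trivial b
  obtain ⟨s, hs⟩ := h.surjective.hasRightInverse
  refine ⟨fun x => if x ∈ U then σ x else s x, ?_, fun x => ?_⟩
  · refine SmoothAt.congr ((mapOn_iff hU).1 hσ b hbU) ?_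
    filter_upwards [hU.mem_nhds hbU] with x hx
    simp [hx]
  · by_cases hx : x ∈ U
    · simp [hx, hπσ x hx]
    · simp [hx, hs x]

namespace IsSplitLieSubgroup

variable {K : Subgroup P} [K.Normal] {AK : Smooth 𝕜 K} {AQ : Smooth 𝕜 (P ⧸ K)}

/-- The quotient of a Lie group by a normal split Lie subgroup is a Lie group. -/
theorem isLieGroup_quotient (h : IsSplitLieSubgroup AP K AK AQ) (hP : IsLieGroup AP) :
    IsLieGroup AQ where
  mul := by
    refine map_iff.2 fun ⟨a, b⟩ => ?_
    obtain ⟨σ, hσ, hmk⟩ := h.bundle.exists_section a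
    obtain ⟨σ', hσ', hmk'⟩ := h.bundle.exists_section b
    refine (SmoothAt.comp (h.bundle.smooth_proj.smoothAt _) (hP.smoothAt_mul
      (SmoothAt.comp (f := fun p : (P ⧸ K) × (P ⧸ K) => p.1) hσ (smoothAt_fst _ _ (a, b)))
      (SmoothAt.comp (f := fun p : (P ⧸ K) × (P ⧸ K) => p.2) hσ'
        (smoothAt_snd _ _ (a, b))))).congr (Eventually.of_forall fun p => ?_)
    rw [QuotientGroup.mk_mul, hmk, hmk']
  inv := by
    refine map_iff.2 fun a => ?_
    obtain ⟨σ, hσ, hmk⟩ := h.bundle.exists_section a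
    refine (SmoothAt.comp (h.bundle.smooth_proj.smoothAt _) (hP.smoothAt_inv hσ)).congr
      (Eventually.of_forall fun p => ?_)
    rw [QuotientGroup.mk_inv, hmk]

theorem isLieExtension (h : IsSplitLieSubgroup AP K AK AQ) (hP : IsLieGroup AP) :
    IsLieExtension AK AP AQ K.subtype (QuotientGroup.mk' K) where
  lie_left := h.lie
  lie_mid := hP
  lie_right := h.isLieGroup_quotient hP
  exact := by simp
  bundle := h.bundle

end IsSplitLieSubgroup

/-- Joint smoothness of `(g, n) ↦ S(g)(n)` is available only for `g` near `1`, whence the condition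
on `f x`. -/
theorem IsC1sAut.smoothAt_apply {S : G → MulAut N} (hS : IsC1sAut AG AN S) {f : M → G}
    {k : M → N} {x : M} (hf : SmoothAt C AG f x) (h1 : f x = 1) (hk : SmoothAt C AN k x) :
    SmoothAt C AN (fun y => S (f y) (k y)) x := by
  obtain ⟨U, hU, h1U, hSU⟩ := hS.locally_smooth
  have hU' := hU.prod AN.open_univ
  exact SmoothAt.comp (g := fun p : G × N => S p.1 p.2) (f := fun y => (f y, k y))
    ((mapOn_iff hU').1 hSU _ ⟨by rwa [h1], mem_univ _⟩) (hf.prodMk hk)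

theorem IsC1sAut.smoothAt {S : G → MulAut N} (hS : IsC1sAut AG AN S) (g : G) (n : N) :
    SmoothAt AN AN (S g) n :=
  (hS.diffeo g).1.smoothAt n

namespace GS

variable (S : OuterAction AG AN)

/-- The bijection `N_ad × G → G^S`. -/
def prodEquiv : Nad N × G ≃ GS S where
  toFun p := ⟨p.1, p.2⟩
  invFun x := (x.fst, x.snd)

/-- The product manifold structure on `G^S = N_ad × G`. -/
def prodSmooth (Aad : Smooth 𝕜 (Nad N)) : Smooth 𝕜 (GS S) := (Aad.prod AG).congr (prodEquiv S)

variable {S}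

theorem smoothAt_prodSmooth {f : M → GS S} {x : M}
    (h1 : SmoothAt C Aad (fun y => (f y).fst) x) (h2 : SmoothAt C AG (fun y => (f y).snd) x) :
    SmoothAt C (prodSmooth S Aad) f x :=
  SmoothAt.comp (f := fun y => ((f y).fst, (f y).snd)) (g := prodEquiv S)
    (((Aad.prod AG).congr_smooth (prodEquiv S)).smoothAt _) (h1.prodMk h2)

theorem smoothAt_fst_snd (x : GS S) :
    SmoothAt (prodSmooth S Aad) (Aad.prod AG) (fun y => (y.fst, y.snd)) x :=
  ((Aad.prod AG).congr_symm_smooth (prodEquiv S)).smoothAt x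

theorem smoothAt_fst {f : M → GS S} {x : M} (hf : SmoothAt C (prodSmooth S Aad) f x) :
    SmoothAt C Aad (fun y => (f y).fst) x :=
  (SmoothAt.comp (smoothAt_fst_snd _) hf).fst

theorem smoothAt_snd {f : M → GS S} {x : M} (hf : SmoothAt C (prodSmooth S Aad) f x) :
    SmoothAt C AG (fun y => (f y).snd) x :=
  (SmoothAt.comp (smoothAt_fst_snd _) hf).snd

section Coordinates

variable {ω : G → G → N}

/-- Arbitrary representatives are allowed so that values of a smooth local section of `N → N_ad` can
be inserted. -/
theorem mul_fst (hω : ∀ g g', S.delta g g' = MulAut.conj (ω g g'))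
    (x y : GS S) {n n' : N} (hn : (n : Nad N) = x.fst) (hn' : (n' : Nad N) = y.fst) :
    (x * y).fst = ((n * S x.snd n' * ω x.snd y.snd : N) : Nad N) := by
  obtain ⟨a, g⟩ := x
  obtain ⟨b, h⟩ := y
  obtain rfl : (n : Nad N) = a := hn
  obtain rfl : (n' : Nad N) = b := hn'
  rw [mk_mul_mk hω]

theorem inv_fst (hω : ∀ g g', S.delta g g' = MulAut.conj (ω g g'))
    (x : GS S) {n : N} (hn : (n : Nad N) = x.fst) :
    x⁻¹.fst = (((S x.snd⁻¹ n * ω x.snd⁻¹ x.snd)⁻¹ : N) : Nad N) := by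
  have h : (⟨(((S x.snd⁻¹ n * ω x.snd⁻¹ x.snd)⁻¹ : N) : Nad N), x.snd⁻¹⟩ : GS S) * x = 1 := by
    refine GS.ext ?_ (inv_mul_cancel _)
    rw [mul_fst hω _ x rfl hn, mul_assoc, inv_mul_cancel]
    rfl
  rw [← eq_inv_of_mul_eq_one_left h]

/-- The factor `ω(g, x) ω(g x g⁻¹, g)⁻¹` appearing here is the one whose smoothness near `1` is
required in `C^2_{ss}`. -/
theorem conj_base (hω : ∀ g g', S.delta g g' = MulAut.conj (ω g g'))
    (g : G) (x : GS S) {n : N} (hn : (n : Nad N) = x.fst) :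
    (⟨1, g⟩ : GS S) * x * ⟨1, g⟩⁻¹ =
      ⟨((S g n * (ω g x.snd * (ω (g * x.snd * g⁻¹) g)⁻¹) : N) : Nad N), g * x.snd * g⁻¹⟩ := by
  rw [mul_inv_eq_iff_eq_mul]
  refine GS.ext ?_ (by simp [mul_snd])
  rw [mul_fst hω _ x (n := 1) rfl hn, mul_fst hω _ _ (n' := 1) rfl rfl]
  simp [mul_assoc]

/-- Conjugation by an element of `N_ad` involves only `S(h)(m)` with `h` the `G`-component, and this
is smooth for `h` near `1`. -/
theorem conj_fibre (hω : ∀ g g', S.delta g g' = MulAut.conj (ω g g'))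
    (hω1 : ∀ g, ω 1 g = 1) (hω2 : ∀ g, ω g 1 = 1) (m : N) (x : GS S) {n : N}
    (hn : (n : Nad N) = x.fst) :
    (⟨(m : Nad N), 1⟩ : GS S) * x * ⟨(m : Nad N), 1⟩⁻¹ =
      ⟨((m * n * (S x.snd m)⁻¹ : N) : Nad N), x.snd⟩ := by
  rw [mul_inv_eq_iff_eq_mul]
  refine GS.ext ?_ (by simp [mul_snd])
  rw [mul_fst hω _ x (n := m) rfl hn, mul_fst hω _ _ (n' := m) rfl rfl]
  simp [hω1, hω2, S.isC1sAut.one]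

end Coordinates

/-- The product structure on `N_ad × U` is compatible with the multiplication of `G^S`. -/
theorem exists_localLieGroup (hG : IsLieGroup AG) (hN : IsLieGroup AN)
    (hZ : IsSplitLieSubgroup AN (Subgroup.center N) AZ Aad) (S : OuterAction AG AN) :
    ∃ U : Set G, AG.Open U ∧ 1 ∈ U ∧
      LocalLieGroup (prodSmooth S Aad) (proj S ⁻¹' U) := by
  obtain ⟨ω, hωs, hω'⟩ := S.exists_omega
  have hω : ∀ g g', S.delta g g' = MulAut.conj (ω g g') := hω'
  have hS := S.isC1sAut
  have hmk (n : N) : SmoothAt AN Aad (fun n => (n : Nad N)) n := hZ.bundle.smooth_proj.smoothAt n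
  obtain ⟨O, hO, h1O, hωO⟩ := hωs.locally_smooth
  have hωO := (mapOn_iff hO).1 hωO
  have hO1 : O ∈ AG.nhds 1 ×ˢ AG.nhds 1 := by
    rw [← nhds_prod]
    exact hO.mem_nhds h1O
  -- Choose `W` with `ω` smooth on `W × W`, and then `U` with `U U⁻¹ ⊆ W`.
  obtain ⟨W', hW', hWO⟩ := mem_prod_self_iff.1 hO1
  obtain ⟨W, hWW', hW, h1W⟩ := Smooth.mem_nhds_iff.1 hW'
  have hdiv : SmoothAt (AG.prod AG) AG (fun p => p.1 * p.2⁻¹) (1, 1) :=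
    hG.smoothAt_mul (Smooth.smoothAt_fst _ _ _)
      (hG.smoothAt_inv (Smooth.smoothAt_snd _ _ (1, 1)))
  have hW1 : W ∈ AG.nhds ((1 : G) * 1⁻¹) := by simpa using hW.mem_nhds h1W
  have hpre := hdiv.tendsto hW1
  rw [nhds_prod, mem_map, mem_prod_self_iff] at hpre
  obtain ⟨U', hU', hUW⟩ := hpre
  obtain ⟨U, hUU', hU, h1U⟩ := Smooth.mem_nhds_iff.1 hU'
  have hproj : (prodSmooth S Aad).Map AG (proj S) :=
    map_iff.2 fun x => smoothAt_snd (smoothAt_id _ x)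
  have hfst (x : GS S) : SmoothAt (prodSmooth S Aad) Aad (fun y => y.fst) x :=
    smoothAt_fst (smoothAt_id _ x)
  have hsnd (x : GS S) : SmoothAt (prodSmooth S Aad) AG (fun y => y.snd) x :=
    smoothAt_snd (smoothAt_id _ x)
  obtain ⟨σ, hσ, hσmk⟩ := hZ.bundle.exists_section (1 : Nad N)
  refine ⟨U ∩ W, hU.inter hW, ⟨h1U, h1W⟩, Open.preimage hproj (hU.inter hW), ⟨h1U, h1W⟩,
    ?_, ?_, ?_, ?_⟩
  · intro k x hx hkx
    -- The element `k` is arbitrary, but `x` and `k x` both lie over `U`; hence its `G`-component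
    -- lies in `U U⁻¹ ⊆ W`, where `ω` is under control.
    have hk : k.snd ∈ W := by
      have h1 : ((k * x).snd, x.snd) ∈ U' ×ˢ U' := ⟨hUU' hkx.1, hUU' hx.1⟩
      have h2 : (k * x).snd * x.snd⁻¹ ∈ W := hUW h1
      rwa [mul_snd, mul_inv_cancel_right] at h2
    obtain ⟨s, hs, hsmk⟩ := hZ.bundle.exists_section x.fst
    obtain ⟨m, hm⟩ := QuotientGroup.mk_surjective k.fst
    have hωk : SmoothAt AG AN (fun h => ω k.snd h) x.snd :=
      SmoothAt.comp (f := fun h => (k.snd, h)) (g := fun p : G × G => ω p.1 p.2)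
        (hωO _ (hWO ⟨hWW' hk, hWW' hx.2⟩))
        ((smoothAt_const _ _ _ _).prodMk (smoothAt_id _ _))
    refine smoothAt_prodSmooth ?_ (hG.smoothAt_const_mul k.snd (hsnd x))
    refine (SmoothAt.comp (hmk _) (hN.smoothAt_mul (hN.smoothAt_const_mul m
      (SmoothAt.comp (hS.smoothAt k.snd _) (SmoothAt.comp hs (hfst x))))
      (SmoothAt.comp hωk (hsnd x)))).congr (Eventually.of_forall fun y => ?_)
    exact (mul_fst hω k y hm (hsmk y.fst)).symm
  · have h1 : SmoothAt ((prodSmooth S Aad).prod (prodSmooth S Aad)) (prodSmooth S Aad)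
        (fun p => p.1) (1, 1) := Smooth.smoothAt_fst _ _ _
    have h2 : SmoothAt ((prodSmooth S Aad).prod (prodSmooth S Aad)) (prodSmooth S Aad)
        (fun p => p.2) (1, 1) := Smooth.smoothAt_snd _ _ _
    refine smoothAt_prodSmooth ?_ (hG.smoothAt_mul (smoothAt_snd h1) (smoothAt_snd h2))
    refine (SmoothAt.comp (hmk _) (hN.smoothAt_mul (hN.smoothAt_mul
      (SmoothAt.comp (f := fun p : GS S × GS S => p.1.fst) hσ (smoothAt_fst h1))
      (hS.smoothAt_apply (f := fun p : GS S × GS S => p.1.snd) (smoothAt_snd h1) rfl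
        (SmoothAt.comp (f := fun p : GS S × GS S => p.2.fst) hσ (smoothAt_fst h2))))
      (SmoothAt.comp (f := fun p : GS S × GS S => (p.1.snd, p.2.snd))
        (g := fun p : G × G => ω p.1 p.2) (hωO _ h1O)
        ((smoothAt_snd h1).prodMk (smoothAt_snd h2))))).congr (Eventually.of_forall fun y => ?_)
    exact (mul_fst hω y.1 y.2 (hσmk _) (hσmk _)).symm
  · refine smoothAt_prodSmooth ?_ (hG.smoothAt_inv (hsnd 1))
    have hi : SmoothAt (prodSmooth S Aad) AG (fun x => x.snd⁻¹) 1 := hG.smoothAt_inv (hsnd 1)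
    refine (SmoothAt.comp (hmk _) (hN.smoothAt_inv (hN.smoothAt_mul
      (hS.smoothAt_apply hi inv_one
        (SmoothAt.comp (f := fun x : GS S => x.fst) hσ (hfst 1)))
      (SmoothAt.comp (f := fun x : GS S => (x.snd⁻¹, x.snd))
        (g := fun p : G × G => ω p.1 p.2) (hωO _ (by simpa [one_snd] using h1O))
        (hi.prodMk (hsnd 1)))))).congr (Eventually.of_forall fun y => ?_)
    exact (inv_fst hω y (hσmk _)).symm
  · intro k
    obtain ⟨a, g⟩ := k
    obtain ⟨m, rfl⟩ := QuotientGroup.mk_surjective a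
    have hb : SmoothAt (prodSmooth S Aad) (prodSmooth S Aad)
        (fun x => (⟨1, g⟩ : GS S) * x * ⟨1, g⟩⁻¹) 1 := by
      refine smoothAt_prodSmooth ?_
        (hG.smoothAt_mul_const g⁻¹ (hG.smoothAt_const_mul g (hsnd 1)))
      refine (SmoothAt.comp (hmk _) (hN.smoothAt_mul
        (SmoothAt.comp (hS.smoothAt g _)
          (SmoothAt.comp (f := fun x : GS S => x.fst) hσ (hfst 1)))
        (SmoothAt.comp (f := fun x : GS S => x.snd)
          (g := fun x => ω g x * (ω (g * x * g⁻¹) g)⁻¹) (hωs.strongly g) (hsnd 1)))).congr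
        (Eventually.of_forall fun y => ?_)
      exact congrArg GS.fst (conj_base hω g y (hσmk y.fst)).symm
    have hf : SmoothAt (prodSmooth S Aad) (prodSmooth S Aad)
        (fun x => (⟨(m : Nad N), 1⟩ : GS S) * x * ⟨(m : Nad N), 1⟩⁻¹) 1 := by
      refine SmoothAt.congr (f := fun x : GS S =>
        ⟨((m * σ x.fst * (S x.snd m)⁻¹ : N) : Nad N), x.snd⟩)
        (smoothAt_prodSmooth ?_ (hsnd 1)) (Eventually.of_forall fun y => ?_)
      · change SmoothAt _ _ (fun x : GS S => ((m * σ x.fst * (S x.snd m)⁻¹ : N) : Nad N)) 1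
        exact SmoothAt.comp (hmk _) (hN.smoothAt_mul (hN.smoothAt_const_mul m
          (SmoothAt.comp (f := fun x : GS S => x.fst) hσ (hfst 1)))
          (hN.smoothAt_inv (hS.smoothAt_apply (hsnd 1) rfl (smoothAt_const _ _ m _))))
      · exact (conj_fibre hω hωs.one_left hωs.one_right m y (hσmk y.fst)).symm
    have hk : (⟨(m : Nad N), g⟩ : GS S) = ⟨(m : Nad N), 1⟩ * ⟨1, g⟩ := by
      refine GS.ext ?_ (by simp [mul_snd])
      rw [mul_fst hω _ _ (n := m) (n' := 1) rfl rfl]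
      simp [hωs.one_left]
    rw [hk]
    exact smoothAt_conj_mul hf hb

theorem exists_isNatural (hG : IsLieGroup AG) (hN : IsLieGroup AN)
    (hZ : IsSplitLieSubgroup AN (Subgroup.center N) AZ Aad) (S : OuterAction AG AN) :
    ∃ L : Smooth 𝕜 (GS S), IsNatural S Aad L := by
  obtain ⟨U, hU, h1U, h⟩ := exists_localLieGroup hG hN hZ S
  have hV : h.smooth.Open (proj S ⁻¹' U) := h.isOpen_of_subset h.isOpen subset_rfl
  refine ⟨h.smooth, h.isLieGroup, U, hU, h1U, hV, ?_, ?_⟩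
  · refine (mapOn_iff (Aad.open_univ.prod hU)).2 fun p hp => ?_
    exact SmoothAt.comp (g := fun x => x) (f := fun p : Nad N × G => (⟨p.1, p.2⟩ : GS S))
      (h.smoothAt_to hp.2)
      (smoothAt_prodSmooth (Smooth.smoothAt_fst _ _ p) (Smooth.smoothAt_snd _ _ p))
  · exact (mapOn_iff hV).2 fun x hx => SmoothAt.comp (f := fun x => x)
      (smoothAt_fst_snd x) (h.smoothAt_from hx)

end GS
end
/-! ### The extension of `G^S` by `Z(N)` defined by an extension of `G` by `N` -/

open Smooth

section

variable {𝕜 : Type v} [RCLike 𝕜] {G N M : Type u} [Group G] [Group N]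
  {AG : Smooth 𝕜 G} {AN : Smooth 𝕜 N} {AZ : Smooth 𝕜 (Subgroup.center N)}
  {Aad : Smooth 𝕜 (Nad N)} {C : Smooth 𝕜 M} {S : OuterAction AG AN} {L : Smooth 𝕜 (GS S)}

namespace GS

theorem smoothAt_rho (hN : IsLieGroup AN) (x : GS S) (n : N) : SmoothAt AN AN (rho S x) n := by
  obtain ⟨m, hm⟩ := QuotientGroup.mk_surjective x.fst
  refine (hN.smoothAt_mul_const m⁻¹ (hN.smoothAt_const_mul m
    (S.isC1sAut.smoothAt x.snd n))).congr (Eventually.of_forall fun y => ?_)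
  change _ = (ad N x.fst * S x.snd) y
  rw [← hm, ad_mk]
  simp

theorem rho_eq_of_mem_center (x : GS S) {z : N} (hz : z ∈ Subgroup.center N) :
    rho S x z = S x.snd z := by
  obtain ⟨m, hm⟩ := QuotientGroup.mk_surjective x.fst
  have h1 : S x.snd z ∈ Subgroup.center N := (Subgroup.centerCongr (S x.snd) ⟨z, hz⟩).2
  change (ad N x.fst * S x.snd) z = _
  rw [← hm, ad_mk]
  simp only [MulAut.mul_apply, MulAut.conj_apply]
  rw [Subgroup.mem_center_iff.1 h1 m, mul_inv_cancel_right]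

namespace IsNatural

theorem smoothAt_one (hL : IsNatural S Aad L) :
    SmoothAt L (Aad.prod AG) (fun x => (x.fst, x.snd)) 1 := by
  obtain ⟨U, -, h1U, hU, -, h⟩ := hL.product
  exact (mapOn_iff hU).1 h 1 h1U

/-- Near `1` the natural structure is the product one, so components suffice there; elsewhere the
product structure need not be natural. -/
theorem smoothAt_of_eq_one (hL : IsNatural S Aad L) {f : M → GS S} {x : M}
    (h1 : SmoothAt C Aad (fun y => (f y).fst) x) (h2 : SmoothAt C AG (fun y => (f y).snd) x)
    (hx : f x = 1) : SmoothAt C L f x := by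
  obtain ⟨U, hU, h1U, -, h, -⟩ := hL.product
  refine SmoothAt.comp (g := fun p : Nad N × G => (⟨p.1, p.2⟩ : GS S))
    (f := fun y => ((f y).fst, (f y).snd)) ?_ (h1.prodMk h2)
  refine (mapOn_iff (Aad.open_univ.prod hU)).1 h _ ⟨mem_univ _, ?_⟩
  rw [hx]
  exact h1U

theorem map_proj (hL : IsNatural S Aad L) (hG : IsLieGroup AG) : L.Map AG (proj S) :=
  hL.lie.map_of_smoothAt_one hG (φ := proj S) hL.smoothAt_one.snd

/-- Near `x` write `ρ(y) z = ρ(x) ρ(x⁻¹ y) z`. Inner automorphisms fix the centre, so `ρ(x⁻¹ y) z =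
S(q_S(x⁻¹ y)) z`, which is jointly smooth because `q_S(x⁻¹ y)` is near `1`. Initiality of `Z(N)` in
`N` concludes. -/
theorem map_rhoZ (hL : IsNatural S Aad L) (hN : IsLieGroup AN) (hG : IsLieGroup AG)
    (hZ : IsSplitLieSubgroup AN (Subgroup.center N) AZ Aad) :
    (L.prod AZ).Map AZ (fun p => rhoZ S p.1 p.2) := by
  refine map_iff.2 fun ⟨x, z⟩ => hZ.bundle.isInitial hZ.lie _ _ _ _ ?_
  have h1 : SmoothAt (L.prod AZ) AG (fun p => x.snd⁻¹ * proj S p.1) (x, z) :=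
    hG.smoothAt_const_mul _ (SmoothAt.comp (f := fun p : GS S × Subgroup.center N => p.1)
      ((hL.map_proj hG).smoothAt _) (Smooth.smoothAt_fst _ _ (x, z)))
  have h2 : SmoothAt (L.prod AZ) AN (fun p => (p.2 : N)) (x, z) :=
    SmoothAt.comp (f := fun p : GS S × Subgroup.center N => p.2)
      (hZ.bundle.smooth_incl.smoothAt _) (Smooth.smoothAt_snd _ _ (x, z))
  refine (SmoothAt.comp (smoothAt_rho hN x _) (S.isC1sAut.smoothAt_apply h1
    (inv_mul_cancel _) h2)).congr (Eventually.of_forall fun p => ?_)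
  have h3 : S (x.snd⁻¹ * proj S p.1) p.2 = rho S (x⁻¹ * p.1) p.2 :=
    (rho_eq_of_mem_center (x⁻¹ * p.1) p.2.2).symm
  rw [h3, ← MulAut.mul_apply, ← map_mul, mul_inv_cancel_left]
  rfl

end IsNatural
end GS

namespace LieExt

theorem conjN_eq_iff (E : LieExt AG AN) (x : E.carrier) (n m : N) :
    E.conjN x n = m ↔ x * E.ι n * x⁻¹ = E.ι m := by
  rw [← E.ι_conjN, E.ι_injective.eq_iff]

theorem conjN_ι (E : LieExt AG AN) (n : N) : E.conjN (E.ι n) = MulAut.conj n := by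
  ext m
  rw [conjN_eq_iff]
  simp

/-- Write `x = ι(n) σ(q x)` and use `C_N ∘ σ = (C_N ∘ h) · S`. This is why `γ` takes values in
`G^S`. -/
theorem exists_conjN_eq {E : LieExt AG AN} (hE : E.CorrespondsTo S) (x : E.carrier) :
    ∃ n : N, E.conjN x = MulAut.conj n * S (E.q x) := by
  obtain ⟨σ, -, hqσ, h, -, hσ⟩ := hE
  obtain ⟨n, hn⟩ := E.isExt.exists_ι_eq (x := x * (σ (E.q x))⁻¹)
    (by rw [map_mul, map_inv, hqσ, mul_inv_cancel])
  refine ⟨n * h (E.q x), ?_⟩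
  rw [map_mul, mul_assoc, ← hσ, ← E.conjN_ι, hn, ← map_mul, inv_mul_cancel_right]

/-- The underlying map of `γ`. -/
noncomputable def gammaFun (E : LieExt AG AN) (hE : E.CorrespondsTo S) (x : E.carrier) : GS S :=
  ⟨((exists_conjN_eq hE x).choose : Nad N), E.q x⟩

theorem rhoFun_gammaFun (E : LieExt AG AN) (hE : E.CorrespondsTo S) (x : E.carrier) :
    GS.rhoFun (E.gammaFun hE x) = E.conjN x :=
  (exists_conjN_eq hE x).choose_spec.symm

/-- The homomorphism `γ : E → G^S`. -/
noncomputable def gamma (E : LieExt AG AN) (hE : E.CorrespondsTo S) : E.carrier →* GS S where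
  toFun := E.gammaFun hE
  map_one' := GS.ext_rho (by rw [rhoFun_gammaFun, map_one, GS.rhoFun_one]) (map_one E.q)
  map_mul' x y := GS.ext_rho
    (by rw [GS.rhoFun_mul, rhoFun_gammaFun, rhoFun_gammaFun, rhoFun_gammaFun, map_mul])
    (map_mul E.q x y)

theorem rho_gamma (E : LieExt AG AN) (hE : E.CorrespondsTo S) (x : E.carrier) :
    GS.rho S (E.gamma hE x) = E.conjN x :=
  E.rhoFun_gammaFun hE x

theorem gamma_snd (E : LieExt AG AN) (hE : E.CorrespondsTo S) (x : E.carrier) :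
    (E.gamma hE x).snd = E.q x :=
  rfl

/-- Since `ρ` and `q_S` are jointly injective, `γ` is characterized without reference to the
representative chosen in `gammaFun`. -/
theorem gamma_eq_iff (E : LieExt AG AN) (hE : E.CorrespondsTo S) (x : E.carrier) (y : GS S) :
    E.gamma hE x = y ↔ E.conjN x = GS.rho S y ∧ E.q x = y.snd := by
  constructor
  · rintro rfl
    exact ⟨(E.rho_gamma hE x).symm, rfl⟩
  · rintro ⟨h1, h2⟩
    exact GS.ext_rho ((E.rho_gamma hE x).trans h1) h2

theorem gamma_ι (E : LieExt AG AN) (hE : E.CorrespondsTo S) (n : N) :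
    E.gamma hE (E.ι n) = GS.incl S n := by
  rw [gamma_eq_iff, E.isExt.q_ι, conjN_ι]
  refine ⟨?_, rfl⟩
  change _ = ad N n * S 1
  rw [S.isC1sAut.one, mul_one, ad_mk]

theorem toAutProd_gamma (E : LieExt AG AN) (hE : E.CorrespondsTo S) (x : E.carrier) :
    GS.toAutProd S (E.gamma hE x) = E.gammaMap S x := by
  refine Prod.ext ?_ rfl
  change ad N (E.gamma hE x).fst = E.conjN x * (S (E.q x))⁻¹
  rw [← E.rho_gamma hE, eq_mul_inv_iff_mul_eq]
  rfl

/-- The `N_ad`-component of `γ(x)` is the class of `τ(x) h(q x)`, where `x = ι(τ(x)) σ(q x)`;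
initiality of `ι` makes `τ` smooth at `1`. -/
theorem smoothAt_gamma_one (hL : GS.IsNatural S Aad L)
    (hZ : IsSplitLieSubgroup AN (Subgroup.center N) AZ Aad) (E : LieExt AG AN)
    (hE : E.CorrespondsTo S) : SmoothAt E.str L (E.gamma hE) 1 := by
  obtain ⟨σ, ⟨-, hσs⟩, hqσ, h, ⟨-, hs⟩, hσ⟩ := id hE
  have hex (x : E.carrier) := E.isExt.exists_ι_eq (x := x * (σ (E.q x))⁻¹)
    (by rw [map_mul, map_inv, hqσ, mul_inv_cancel])
  choose τ hτ using hex
  have hN := E.isExt.lie_left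
  have hlie := E.isExt.lie_mid
  have hq : SmoothAt E.str AG E.q 1 := E.isExt.bundle.smooth_proj.smoothAt 1
  have hs' : SmoothAt E.str AN (fun x => h (E.q x)) 1 :=
    SmoothAt.comp (by rw [map_one]; exact hs) hq
  have hσ' : SmoothAt E.str E.str (fun x => σ (E.q x)) 1 :=
    SmoothAt.comp (by rw [map_one]; exact hσs) hq
  have hτ' : SmoothAt E.str AN τ 1 := by
    refine E.isExt.isInitial _ _ _ _ ?_
    simp only [hτ]
    exact hlie.smoothAt_mul (smoothAt_id _ _) (hlie.smoothAt_inv hσ')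
  refine hL.smoothAt_of_eq_one ?_ hq (map_one _)
  refine (SmoothAt.comp (hZ.bundle.smooth_proj.smoothAt _) (hN.smoothAt_mul hτ' hs')).congr
    (Eventually.of_forall fun x => ?_)
  have h1 : E.gamma hE x = ⟨((τ x * h (E.q x) : N) : Nad N), E.q x⟩ := by
    rw [gamma_eq_iff]
    refine ⟨?_, rfl⟩
    change _ = ad N _ * S (E.q x)
    rw [ad_mk, map_mul, mul_assoc, ← hσ, ← E.conjN_ι, hτ, ← map_mul, inv_mul_cancel_right]
  rw [h1]

/-- A section is `(a, g) ↦ ι(ν(a) h(g)⁻¹) σ(g)`, with `ν` a section of `N → N_ad`: the factor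
`h(g)⁻¹` corrects `C_N(σ(g))` to `S(g)`. -/
theorem exists_gamma_section (hL : GS.IsNatural S Aad L)
    (hZ : IsSplitLieSubgroup AN (Subgroup.center N) AZ Aad) (E : LieExt AG AN)
    (hE : E.CorrespondsTo S) :
    ∃ s : GS S → E.carrier, SmoothAt L E.str s 1 ∧ ∀ x, E.gamma hE (s x) = x := by
  obtain ⟨σ, ⟨-, hσs⟩, hqσ, h, ⟨-, hs⟩, hσ⟩ := id hE
  obtain ⟨ν, hν, hmk⟩ := hZ.bundle.exists_section (1 : Nad N)
  have hN := E.isExt.lie_left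
  refine ⟨fun x => E.ι (ν x.fst * (h x.snd)⁻¹) * σ x.snd, ?_, fun x => ?_⟩
  · have h1 : SmoothAt L Aad (fun x => x.fst) 1 := hL.smoothAt_one.fst
    have h2 : SmoothAt L AG (fun x => x.snd) 1 := hL.smoothAt_one.snd
    exact E.isExt.lie_mid.smoothAt_mul (SmoothAt.comp (E.isExt.bundle.smooth_incl.smoothAt _)
      (hN.smoothAt_mul (SmoothAt.comp (f := fun x : GS S => x.fst) hν h1)
        (hN.smoothAt_inv (SmoothAt.comp (f := fun x : GS S => x.snd) hs h2))))
      (SmoothAt.comp (f := fun x : GS S => x.snd) hσs h2)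
  · have hσ' : E.conjN (σ x.snd) = MulAut.conj (h x.snd) * S x.snd := hσ x.snd
    rw [gamma_eq_iff]
    refine ⟨?_, by rw [map_mul, E.isExt.q_ι, hqσ, one_mul]⟩
    change _ = ad N x.fst * S x.snd
    rw [map_mul, conjN_ι, hσ', ← ad_mk, QuotientGroup.mk_mul, QuotientGroup.mk_inv, hmk, map_mul,
      map_inv, ad_mk, mul_assoc, inv_mul_cancel_left]

/-- The kernel of `γ` consists of the `x` with `q x = 1` acting trivially on `N`, that is, of
`ι(Z(N))`. -/
theorem isLieExtension_gamma (hL : GS.IsNatural S Aad L)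
    (hZ : IsSplitLieSubgroup AN (Subgroup.center N) AZ Aad) (E : LieExt AG AN)
    (hE : E.CorrespondsTo S) :
    IsLieExtension AZ E.str L (E.ι.comp (Subgroup.center N).subtype) (E.gamma hE) := by
  obtain ⟨s, hs, hγs⟩ := E.exists_gamma_section hL hZ hE
  refine IsLieExtension.of_section hZ.lie E.isExt.lie_mid hL.lie ?_
    (E.ι_injective.comp Subtype.val_injective) (map_iff.2 fun z => ?_)
    (E.isExt.lie_mid.map_of_smoothAt_one hL.lie (E.smoothAt_gamma_one hL hZ hE))
    (E.isExt.isInitial.comp (hZ.bundle.isInitial hZ.lie)) hs hγs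
  · ext x
    rw [MonoidHom.mem_ker, gamma_eq_iff, map_one]
    constructor
    · rintro ⟨z, rfl⟩
      refine ⟨?_, E.isExt.q_ι _⟩
      change E.conjN (E.ι z) = 1
      rw [conjN_ι, ← MonoidHom.mem_ker, ker_conj]
      exact z.2
    · rintro ⟨h1, h2⟩
      obtain ⟨n, rfl⟩ := E.isExt.exists_ι_eq h2
      rw [conjN_ι, ← MonoidHom.mem_ker, ker_conj] at h1
      exact ⟨⟨n, h1⟩, rfl⟩
  · exact SmoothAt.comp (g := E.ι) (E.isExt.bundle.smooth_incl.smoothAt _)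
      (hZ.bundle.smooth_incl.smoothAt z)

theorem exists_quotient_diffeo (hL : GS.IsNatural S Aad L)
    (hZ : IsSplitLieSubgroup AN (Subgroup.center N) AZ Aad) (E : LieExt AG AN)
    (hE : E.CorrespondsTo S) :
    ∃ (K : Smooth 𝕜 E.centerImage) (Q : Smooth 𝕜 (E.carrier ⧸ E.centerImage))
      (e : E.carrier ⧸ E.centerImage ≃* GS S),
      IsSplitLieSubgroup E.str E.centerImage K Q ∧ Q.Diffeo L e.toEquiv ∧
      ∀ x : E.carrier, e (x : E.carrier ⧸ E.centerImage) = E.gamma hE x := by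
  have h := E.isLieExtension_gamma hL hZ hE
  have hK : E.centerImage = (E.ι.comp (Subgroup.center N).subtype).range := by
    rw [MonoidHom.range_comp, Subgroup.range_subtype, centerImage]
  obtain ⟨eN, heN⟩ := h.exists_kernelEquiv hK
  obtain ⟨eQ, heQ⟩ := h.exists_quotientEquiv hK
  exact ⟨_, _, eQ, h.isSplitLieSubgroup eN heN eQ heQ, (L.congr_diffeo eQ.symm.toEquiv).symm, heQ⟩

/-- An extension of `G^S` by `Z(N)` whose conjugation action is given by `ρ` corresponds to the
`G^S`-module structure `ρ`. -/
theorem correspondsTo_rhoZ {F : LieExt L AZ} (h : ∀ x, F.conjN x = GS.rhoZ S (F.q x)) :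
    F.CorrespondsTo (GS.rhoZ S) := by
  obtain ⟨σ, hσ, hqσ⟩ := F.isExt.exists_section
  refine ⟨σ, hσ, hqσ, fun _ => 1, ⟨rfl, smoothAt_const _ _ _ _⟩, fun g => ?_⟩
  rw [map_one, one_mul]
  exact (h _).trans (by rw [hqσ])

theorem overGS_correspondsTo (E : LieExt AG AN) (hE : E.CorrespondsTo S)
    (hγ : IsLieExtension AZ E.str L (E.ι.comp (Subgroup.center N).subtype) (E.gamma hE)) :
    (E.overGS (E.gamma hE) hγ).CorrespondsTo (GS.rhoZ S) := by
  refine correspondsTo_rhoZ fun x => ?_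
  ext z
  congr 1
  rw [conjN_eq_iff]
  change x * E.ι z * x⁻¹ = E.ι (GS.rho S (E.gamma hE x) z)
  rw [rho_gamma, ι_conjN]

namespace Equivalent

theorem refl (E : LieExt AG AN) : E.Equivalent E :=
  ⟨MonoidHom.id _, map_iff.2 fun x => smoothAt_id _ x, rfl, rfl⟩

theorem symm {E₁ E₂ : LieExt AG AN} (h : E₁.Equivalent E₂) : E₂.Equivalent E₁ := by
  obtain ⟨φ, hφ⟩ := h
  obtain ⟨e, -, -, he⟩ := E₁.isExt.exists_mulEquiv E₂.isExt hφ
  exact ⟨_, he⟩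

theorem trans {E₁ E₂ E₃ : LieExt AG AN} (h : E₁.Equivalent E₂) (h' : E₂.Equivalent E₃) :
    E₁.Equivalent E₃ := by
  obtain ⟨φ, hφ⟩ := h
  obtain ⟨ψ, hψ⟩ := h'
  refine ⟨ψ.comp φ, map_iff.2 fun x => SmoothAt.comp (g := ψ) (hψ.smooth.smoothAt _)
    (hφ.smooth.smoothAt x), ?_, ?_⟩
  · rw [MonoidHom.comp_assoc, hφ.comp_left, hψ.comp_left]
  · rw [← MonoidHom.comp_assoc, hψ.comp_right, hφ.comp_right]

/-- An equivalence intertwines the conjugation actions on `N` and the projections to `G`, hence the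
maps `γ`. -/
theorem overGS {E₁ E₂ : LieExt AG AN} (h : E₁.Equivalent E₂) (hE₁ : E₁.CorrespondsTo S)
    (hE₂ : E₂.CorrespondsTo S)
    (hγ₁ : IsLieExtension AZ E₁.str L (E₁.ι.comp (Subgroup.center N).subtype) (E₁.gamma hE₁))
    (hγ₂ : IsLieExtension AZ E₂.str L (E₂.ι.comp (Subgroup.center N).subtype) (E₂.gamma hE₂)) :
    (E₁.overGS (E₁.gamma hE₁) hγ₁).Equivalent (E₂.overGS (E₂.gamma hE₂) hγ₂) := by
  obtain ⟨φ, hφ⟩ := h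
  have hι (n : N) : φ (E₁.ι n) = E₂.ι n := DFunLike.congr_fun hφ.comp_left n
  have hq (x : E₁.carrier) : E₂.q (φ x) = E₁.q x := DFunLike.congr_fun hφ.comp_right x
  refine ⟨φ, hφ.smooth, MonoidHom.ext fun z => hι z, MonoidHom.ext fun x => ?_⟩
  change E₂.gamma hE₂ (φ x) = E₁.gamma hE₁ x
  rw [gamma_eq_iff, rho_gamma, gamma_snd, hq]
  refine ⟨?_, rfl⟩
  ext n
  rw [conjN_eq_iff, ← hι, ← hι, ι_conjN, map_mul, map_mul, map_inv]

end Equivalent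

variable (AG AN) in
-- Equivalence of extensions is symmetric because equivalences are invertible, so equal classes
-- yield an actual equivalence.
theorem mk_eq_mk_iff {S : G → MulAut N} {E₁ E₂ : WithKernel AG AN S} :
    (Quot.mk _ E₁ : Ext AG AN S) = Quot.mk _ E₂ ↔ E₁.1.Equivalent E₂.1 := by
  have h : Equivalence fun E₁ E₂ : WithKernel AG AN S => Equivalent E₁.1 E₂.1 :=
    ⟨fun E => .refl E.1, .symm, .trans⟩
  exact ⟨fun h' => h.eqvGen_iff.1 (Quot.eqvGen_exact h'), fun h' => Quot.sound h'⟩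

end LieExt
end
/-! ### The image of `τ` -/

open Smooth

section

variable {𝕜 : Type v} [RCLike 𝕜] {G N : Type u} [Group G] [Group N]
  {AG : Smooth 𝕜 G} {AN : Smooth 𝕜 N} {AZ : Smooth 𝕜 (Subgroup.center N)}
  {Aad : Smooth 𝕜 (Nad N)} {S : OuterAction AG AN} {L : Smooth 𝕜 (GS S)}

namespace GS

theorem mem_range_incl {x : GS S} : x ∈ (incl S).range ↔ x.snd = 1 :=
  ⟨fun ⟨_, ha⟩ => ha ▸ rfl, fun h => ⟨x.fst, GS.ext rfl h.symm⟩⟩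

end GS

namespace LieExt

theorem mem_preNad {F : LieExt L AZ} {x : F.carrier} : x ∈ F.preNad ↔ (F.q x).snd = 1 :=
  GS.mem_range_incl

theorem preNad_eq_ker (F : LieExt L AZ) : F.preNad = ((GS.proj S).comp F.q).ker := by
  ext x
  exact mem_preNad

instance (F : LieExt L AZ) : F.preNad.Normal := by
  rw [preNad_eq_ker]
  infer_instance

/-- Through the equivalence `e`, the group `F` becomes an extension of `G` by `N` with kernel
`γ⁻¹(N_ad)`. The map `α` is the resulting bijection from `N`, along which the Lie group structure is
transported; equivariance is `ρ ∘ γ = C_N` on `E`. -/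
theorem hasEquivariantEquiv_of_equivalent (hL : GS.IsNatural S Aad L) (hG : IsLieGroup AG)
    (hN : IsLieGroup AN) (hZ : IsSplitLieSubgroup AN (Subgroup.center N) AZ Aad)
    (E : LieExt AG AN) (hE : E.CorrespondsTo S)
    (hγ : IsLieExtension AZ E.str L (E.ι.comp (Subgroup.center N).subtype) (E.gamma hE))
    (F : LieExt L AZ) (h : (E.overGS (E.gamma hE) hγ).Equivalent F) :
    F.HasEquivariantEquiv AN Aad := by
  obtain ⟨φ, hφ⟩ := h
  obtain ⟨e, rfl, he, -⟩ := hγ.exists_mulEquiv F.isExt hφ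
  have hes : E.str.Map F.str e := hφ.smooth
  have hι (z : Subgroup.center N) : e (E.ι z) = F.ι z := DFunLike.congr_fun hφ.comp_left z
  have hq (x : E.carrier) : F.q (e x) = E.gamma hE x := DFunLike.congr_fun hφ.comp_right x
  obtain ⟨σ, ⟨-, hσ⟩, hqσ⟩ := E.isExt.exists_section
  have hext : IsLieExtension AN F.str AG (e.toMonoidHom.comp E.ι) ((GS.proj S).comp F.q) := by
    refine IsLieExtension.of_section (σ := fun g => e (σ g)) hN F.isExt.lie_mid hG ?_
      (e.injective.comp E.ι_injective) (map_iff.2 fun n => ?_) (map_iff.2 fun x => ?_)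
      ((IsInitial.of_leftInverse he e.symm_apply_apply).comp E.isExt.isInitial)
      (SmoothAt.comp (hes.smoothAt _) hσ) fun g => ?_
    · ext x
      obtain ⟨y, rfl⟩ := e.surjective x
      have h1 : e y ∈ ((GS.proj S).comp F.q).ker ↔ y ∈ E.q.ker := by
        rw [MonoidHom.mem_ker, MonoidHom.comp_apply, hq]
        rfl
      rw [h1, ← E.isExt.exact]
      exact ⟨fun ⟨n, hn⟩ => ⟨n, e.injective hn⟩, fun ⟨n, hn⟩ => ⟨n, congrArg e hn⟩⟩
    · exact SmoothAt.comp (g := e) (hes.smoothAt _) (E.isExt.bundle.smooth_incl.smoothAt n)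
    · exact SmoothAt.comp (g := GS.proj S) ((hL.map_proj hG).smoothAt _)
        (F.isExt.bundle.smooth_proj.smoothAt x)
    · change GS.proj S (F.q (e (σ g))) = g
      rw [hq]
      exact hqσ g
  have hK : F.preNad = (e.toMonoidHom.comp E.ι).range := F.preNad_eq_ker.trans hext.exact.symm
  obtain ⟨eN, heN⟩ := hext.exists_kernelEquiv hK
  obtain ⟨eQ, heQ⟩ := hext.exists_quotientEquiv hK
  have hαι (z : Subgroup.center N) : eN z = F.preNadι z := Subtype.ext ((heN _).trans (hι z))
  have hαq (n : N) : F.preNadProj (eN n) = (n : Nad N) := by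
    change (F.q (eN n)).fst = n
    rw [heN]
    change (F.q (e (E.ι n))).fst = n
    rw [hq, gamma_ι]
    rfl
  have hαs : AN.Map (AN.congr eN.toEquiv) eN := AN.congr_smooth eN.toEquiv
  have hαs' : (AN.congr eN.toEquiv).Map AN eN.symm := AN.congr_symm_smooth eN.toEquiv
  obtain ⟨ν, hν, hmk⟩ := hZ.bundle.exists_section (1 : Nad N)
  refine ⟨_, _, hext.isSplitLieSubgroup eN heN eQ heQ, ?_, ?_, eN.toMonoidHom,
    ⟨hαs, MonoidHom.ext hαι, MonoidHom.ext hαq⟩, fun x n => ?_⟩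
  · have hZi : IsInitial AZ (AN.congr eN.toEquiv) F.preNadι := by
      rw [show (F.preNadι : Subgroup.center N → F.preNad) =
          fun z : Subgroup.center N => eN (z : N) from
        funext fun z => (hαι z).symm]
      exact (IsInitial.of_leftInverse hαs' eN.symm_apply_apply).comp
        (hZ.bundle.isInitial hZ.lie)
    refine IsLieExtension.of_section (σ := fun a => eN (ν a)) hZ.lie (hN.congr eN)
      (hZ.isLieGroup_quotient hN) ?_ (fun z z' hz => ?_) (map_iff.2 fun z => ?_)
      (map_iff.2 fun x => ?_) hZi (SmoothAt.comp (hαs.smoothAt _) hν) fun a => ?_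
    · ext x
      obtain ⟨n, rfl⟩ := eN.surjective x
      rw [MonoidHom.mem_ker, hαq, QuotientGroup.eq_one_iff]
      constructor
      · rintro ⟨z, hz⟩
        rw [← hαι] at hz
        exact eN.injective hz ▸ z.2
      · exact fun hn => ⟨⟨n, hn⟩, (hαι ⟨n, hn⟩).symm⟩
    · rw [← hαι, ← hαι] at hz
      exact Subtype.ext (eN.injective hz)
    · exact (SmoothAt.comp (g := eN) (hαs.smoothAt _)
        (hZ.bundle.smooth_incl.smoothAt z)).congr (Eventually.of_forall hαι)
    · refine (SmoothAt.comp (hZ.bundle.smooth_proj.smoothAt _) (hαs'.smoothAt x)).congr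
        (Eventually.of_forall fun y => ?_)
      rw [← hαq, MulEquiv.apply_symm_apply]
    · rw [hαq, hmk]
  · rintro _ ⟨z, rfl⟩
    rw [Subgroup.mem_center_iff]
    intro x
    obtain ⟨n, rfl⟩ := eN.surjective x
    rw [← hαι, ← map_mul, ← map_mul, Subgroup.mem_center_iff.1 z.2 n]
  · obtain ⟨y, rfl⟩ := e.surjective x
    change (eN (GS.rho S (F.q (e y)) n) : F.carrier) = e y * (eN n : F.carrier) * (e y)⁻¹
    rw [heN, heN, hq, rho_gamma]
    change e (E.ι (E.conjN y n)) = e y * e (E.ι n) * (e y)⁻¹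
    rw [ι_conjN, map_mul, map_mul, map_inv]

/-- Take `E` to be `F` itself, with inclusion `α` and projection `q_S ∘ γ`. By equivariance `C_N = ρ
∘ γ`, so the map attached to `E` is the given `γ` and the identity is the required equivalence. -/
theorem exists_equivalent_of_hasEquivariantEquiv (hL : GS.IsNatural S Aad L) (hG : IsLieGroup AG)
    (hN : IsLieGroup AN) (hZ : IsSplitLieSubgroup AN (Subgroup.center N) AZ Aad)
    (F : LieExt L AZ) (h : F.HasEquivariantEquiv AN Aad) :
    F.CorrespondsTo (GS.rhoZ S) ∧ ∃ (E : LieExt AG AN) (hE : E.CorrespondsTo S),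
      ∀ hγ : IsLieExtension AZ E.str L (E.ι.comp (Subgroup.center N).subtype) (E.gamma hE),
        (E.overGS (E.gamma hE) hγ).Equivalent F := by
  obtain ⟨P, Q, hP, hext, -, α, hα, heq⟩ := h
  have hαι (z : Subgroup.center N) : α z = F.preNadι z := DFunLike.congr_fun hα.comp_left z
  have hαF (z : Subgroup.center N) : (α z : F.carrier) = F.ι z := by rw [hαι]; rfl
  obtain ⟨eα, rfl, heα, -⟩ := (hZ.isLieExtension hN).exists_mulEquiv hext hα
  have hαs : AN.Map P eα := hα.smooth
  obtain ⟨s, ⟨hs1, hs⟩, hqs⟩ := F.isExt.exists_section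
  -- Lifting `g ↦ (1, g)` gives a section with `C_N ∘ σ = S` on the nose, since `ρ(1, g) = S(g)`.
  have hmk : SmoothAt AG L (fun g => (⟨1, g⟩ : GS S)) 1 :=
    hL.smoothAt_of_eq_one (smoothAt_const _ _ _ _) (smoothAt_id _ _) rfl
  have hσ : SmoothAt AG F.str (fun g => s ⟨1, g⟩) 1 :=
    SmoothAt.comp (f := fun g => (⟨1, g⟩ : GS S)) hs hmk
  have hEext : IsLieExtension AN F.str AG (F.preNad.subtype.comp eα.toMonoidHom)
      ((GS.proj S).comp F.q) := by
    refine IsLieExtension.of_section hN F.isExt.lie_mid hG ?_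
      (Subtype.val_injective.comp eα.injective) (map_iff.2 fun n => ?_) (map_iff.2 fun x => ?_)
      ((hP.bundle.isInitial hP.lie).comp (IsInitial.of_leftInverse heα eα.symm_apply_apply))
      hσ fun g => ?_
    · rw [← preNad_eq_ker]
      ext x
      constructor
      · rintro ⟨n, rfl⟩
        exact (eα n).2
      · exact fun hx => ⟨eα.symm ⟨x, hx⟩, congrArg Subtype.val (eα.apply_symm_apply ⟨x, hx⟩)⟩
    · exact SmoothAt.comp (g := F.preNad.subtype) (hP.bundle.smooth_incl.smoothAt _)
        (hαs.smoothAt n)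
    · exact SmoothAt.comp (g := GS.proj S) ((hL.map_proj hG).smoothAt _)
        (F.isExt.bundle.smooth_proj.smoothAt x)
    · change GS.proj S (F.q (s ⟨1, g⟩)) = g
      rw [hqs]
      rfl
  let E : LieExt AG AN := ⟨F.carrier, F.str, _, _, hEext⟩
  have hconj (x : F.carrier) : E.conjN x = GS.rho S (F.q x) := by
    ext n
    rw [conjN_eq_iff]
    exact (heq x n).symm
  refine ⟨correspondsTo_rhoZ fun x => ?_, E, ⟨fun g => s ⟨1, g⟩, ⟨hs1, hσ⟩, fun g => ?_,
    fun _ => 1, ⟨rfl, smoothAt_const _ _ _ _⟩, fun g => ?_⟩, fun hγ => ⟨MonoidHom.id _,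
    map_iff.2 fun x => smoothAt_id _ x, MonoidHom.ext hαF, MonoidHom.ext fun x => ?_⟩⟩
  · ext z
    congr 1
    rw [conjN_eq_iff, ← hαF, ← hαF]
    exact (heq x z).symm
  · change GS.proj S (F.q (s ⟨1, g⟩)) = g
    rw [hqs]
    rfl
  · change E.conjN (s ⟨1, g⟩) = _
    rw [hconj, hqs, map_one, one_mul]
    change ad N 1 * S g = S g
    rw [map_one, one_mul]
  · exact ((gamma_eq_iff E _ x (F.q x)).2 ⟨hconj x, rfl⟩).symm

end LieExt
end
end LCLie

/-! ### Assembly of the proposition -/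

theorem mainTheorem7 {𝕜 : Type v} [RCLike 𝕜] {G N : Type u} [Group G] [Group N]
    (AG : LCLie.Smooth 𝕜 G) (AN : LCLie.Smooth 𝕜 N)
    (hG : LCLie.IsLieGroup AG) (hN : LCLie.IsLieGroup AN)
    (AZ : LCLie.Smooth 𝕜 (Subgroup.center N)) (Aad : LCLie.Smooth 𝕜 (LCLie.Nad N))
    (hZ : LCLie.IsSplitLieSubgroup AN (Subgroup.center N) AZ Aad)
    (S : LCLie.OuterAction AG AN) :
    (∃ L : LCLie.Smooth 𝕜 (LCLie.GS S), LCLie.GS.IsNatural S Aad L) ∧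
    ∀ L : LCLie.Smooth 𝕜 (LCLie.GS S), LCLie.GS.IsNatural S Aad L →
      (L.prod AZ).Map AZ (fun p => LCLie.GS.rhoZ S p.1 p.2) ∧
      ∃ γ : ∀ E : LCLie.LieExt.WithKernel AG AN S, E.1.carrier →* LCLie.GS S,
        (∀ E x, LCLie.GS.toAutProd S (γ E x) = E.1.gammaMap S x) ∧
        (∀ E : LCLie.LieExt.WithKernel AG AN S,
          ∃ (K : LCLie.Smooth 𝕜 E.1.centerImage)
            (Q : LCLie.Smooth 𝕜 (E.1.carrier ⧸ E.1.centerImage))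
            (e : E.1.carrier ⧸ E.1.centerImage ≃* LCLie.GS S),
            LCLie.IsSplitLieSubgroup E.1.str E.1.centerImage K Q ∧ Q.Diffeo L e.toEquiv ∧
            ∀ x : E.1.carrier, e (x : E.1.carrier ⧸ E.1.centerImage) = γ E x) ∧
        ∃ hγ : ∀ E, LCLie.IsLieExtension AZ E.1.str L
            (E.1.ι.comp (Subgroup.center N).subtype) (γ E),
          ∃ hρ : ∀ E, (E.1.overGS (γ E) (hγ E)).CorrespondsTo (LCLie.GS.rhoZ S),
            (∀ E₁ E₂ : LCLie.LieExt.WithKernel AG AN S, E₁.1.Equivalent E₂.1 →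
              (E₁.1.overGS (γ E₁) (hγ E₁)).Equivalent (E₂.1.overGS (γ E₂) (hγ E₂))) ∧
            ∃ τ : LCLie.LieExt.Ext AG AN S → LCLie.LieExt.Ext L AZ (LCLie.GS.rhoZ S),
              (∀ E, τ (Quot.mk _ E) = Quot.mk _ ⟨E.1.overGS (γ E) (hγ E), hρ E⟩) ∧
              ∀ F : LCLie.LieExt L AZ,
                (∃ hF : F.CorrespondsTo (LCLie.GS.rhoZ S), Quot.mk _ ⟨F, hF⟩ ∈ Set.range τ) ↔
                  F.HasEquivariantEquiv AN Aad := by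
  refine ⟨LCLie.GS.exists_isNatural hG hN hZ S, fun L hL => ⟨hL.map_rhoZ hN hG hZ,
    fun E => E.1.gamma E.2, fun E => E.1.toAutProd_gamma E.2,
    fun E => E.1.exists_quotient_diffeo hL hZ E.2,
    fun E => E.1.isLieExtension_gamma hL hZ E.2, fun E => E.1.overGS_correspondsTo E.2 _,
    fun E₁ E₂ h => h.overGS E₁.2 E₂.2 _ _,
    Quot.map (fun E => ⟨E.1.overGS (E.1.gamma E.2) (E.1.isLieExtension_gamma hL hZ E.2),
      E.1.overGS_correspondsTo E.2 _⟩) fun E₁ E₂ h => h.overGS E₁.2 E₂.2 _ _,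
    fun _ => rfl, fun F => ⟨?_, fun h => ?_⟩⟩⟩
  · rintro ⟨hF, E, hE⟩
    obtain ⟨E, rfl⟩ := Quot.exists_rep E
    exact LCLie.LieExt.hasEquivariantEquiv_of_equivalent hL hG hN hZ E.1 E.2 _ F
      ((LCLie.LieExt.mk_eq_mk_iff L AZ).1 hE)
  · obtain ⟨hF, E, hE, h⟩ :=
      LCLie.LieExt.exists_equivalent_of_hasEquivariantEquiv hL hG hN hZ F h
    exact ⟨hF, Quot.mk _ ⟨E, hE⟩, (LCLie.LieExt.mk_eq_mk_iff L AZ).2 (h _)⟩
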